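/- Let $I \xleftarrow{s} E \xrightarrow{p} B \xrightarrow{t} I$ be functors of groupoids, defining a polynomial endofunctor $P$. All fibres below are homotopy fibres, and $\int^{b\in B}F(b)$ denotes the homotopy sum (Grothendieck construction) of a functor $F$ from a groupoid $B$ to groupoids. For a groupoid $J$, let $\mathrm{Fam}(J)$ be the groupoid of finite families of objects of $J$: objects are functors $X\to J$ with $X$ a finite set, arrows are bijections $X\cong X'$ together with a $2$-cell over $J$. A tree is a diagram of finite sets $A\xleftarrow{s} M\xrightarrow{p} N\xrightarrow{t} A$ (edges $A$, nodes $N$, nodes with a marked input edge $M$) with $t$ injective, $s$ injective with singleton complement (the root), and such that every edge is taken to the root by some iterate of the map $A\to A$ that fixes the root and sends $s(m)$ to $t(p(m))$. An embedding of trees is a map of such diagrams whose middle square is cartesian. A $P$-tree is a tree with a map of diagrams $(A\leftarrow M\to N\to A)\to(I\leftarrow E\to B\to I)$ commuting up to specified isomorphisms and with homotopy cartesian middle square; an embedding of $P$-trees is an embedding of trees with a compatible $2$-cell over $P$. Let $\mathbf T$ be the groupoid of $P$-trees and their isomorphisms and $\mathbf F=\mathrm{Fam}(\mathbf T)$ the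 groupoid of $P$-forests. Let $R:\mathbf T\to I$ give the colour of the root, $R:\mathbf F\to\mathrm{Fam}(I)$ the family of root colours of a forest, and $L:\mathbf T\to\mathrm{Fam}(I)$ the family of colours of the leaves (the edges not in the image of $t$). Let $\mathbf C$ be the groupoid of cuts: objects are the root-preserving embeddings $c:S\rightarrowtail T$ of $P$-trees, arrows are the isomorphisms of such embeddings. Write $S_c=S$, and let $P_c\in\mathbf F$ be the family, indexed by the leaves $\ell$ of $S$, of the ideal subtrees of $T$ generated by $c(\ell)$ (the edge $c(\ell)$ together with all edges and nodes above it). Let ${}_T\mathbf C$ be the fibre over $T$ of the functor $\mathbf C\to\mathbf T$, $(c:S\rightarrowtail T)\mapsto T$, and let $\mathrm{cut}(T)=\pi_0({}_T\mathbf C)$, regarded as a discrete groupoid. Fix a colour $v\in I$ and let $\mathbf T_v$ be the fibre of $R:\mathbf T\to I$ over $v$. For $N\in\mathrm{Fam}(I)$ let $\mathbf F_N$ be the fibre of $R:\mathbf F\to\mathrm{Fam}(I)$ over $N$, and ${}_N\mathbf T_v$ the fibre over $N$ of $\mathbf T_v\to\mathbf T\xrightarrow{L}\mathrm{Fam}(I)$.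 Then the canonical functor $$q:\int^{T\in\mathbf T_v}{}_T\mathbf C\longrightarrow\int^{T\in\mathbf T_v}\mathrm{cut}(T)$$ is an equivalence, and there is an equivalence of groupoids $$\int^{T\in\mathbf T_v}\mathrm{cut}(T)\;\simeq\;\int^{N\in\mathrm{Fam}(I)}\mathbf F_N\times{}_N\mathbf T_v$$ over $\mathbf F\times\mathbf T_v$. Here the right-hand side is mapped to $\mathbf F\times\mathbf T_v$ by the projections, and the left-hand side by sending a cut $c$ to $(P_c,S_c)$; that is, the composite of $q$, the equivalence and the projections is naturally isomorphic to the functor $c\mapsto(P_c,S_c)$, where $S_c$ lies in $\mathbf T_v$ through the isomorphism of its root colour with that of $T$ given by $c$. -/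

import Mathlib

open CategoryTheory

universe w vI vE vB uI uE uB

namespace FaaDiBruno

/-! ### Families of objects of a groupoid -/

/-- A finite family of objects of `J`, that is, a functor from a finite set (regarded as a
discrete groupoid) to `J`. -/
structure Fam (J : Type uI) where
  /-- the indexing set -/
  idx : Type w
  [fin : Finite idx]
  /-- the members of the family -/
  obj : idx → J

namespace Fam

/-- An arrow of families: a bijection of indexing sets, together with a 2-cell filling the
triangle over `J`. -/
@[ext]
structure Hom {J : Type uI} [Category.{vI} J] (X Y : Fam.{w} J) where
  /-- the map of indexing sets -/
  toFun : X.idx → Y.idx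
  bij : Function.Bijective toFun
  /-- the components of the 2-cell -/
  cell : ∀ i, X.obj i ⟶ Y.obj (toFun i)

variable {J : Type uI} [Category.{vI} J] {K : Type uE} [Category.{vE} K]

instance : Category (Fam.{w} J) where
  Hom X Y := Hom X Y
  id X := ⟨fun i => i, Function.bijective_id, fun i => 𝟙 (X.obj i)⟩
  comp f g := ⟨fun i => g.toFun (f.toFun i), g.bij.comp f.bij,
    fun i => f.cell i ≫ g.cell (f.toFun i)⟩
  id_comp f := by
    cases f; simp
  comp_id f := by
    cases f; simp
  assoc f g h := by
    cases f; cases g; cases h; simp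

/-- The action of a functor `F : J ⥤ K` on families. -/
def map (F : J ⥤ K) : Fam.{w} J ⥤ Fam.{w} K where
  obj X := { idx := X.idx, fin := X.fin, obj := fun i => F.obj (X.obj i) }
  map f := ⟨f.toFun, f.bij, fun i => F.map (f.cell i)⟩
  map_id X := by
    change Hom.mk _ _ _ = Hom.mk _ _ _
    congr 1
    funext i
    exact F.map_id _
  map_comp f g := by
    change Hom.mk _ _ _ = Hom.mk _ _ _
    congr 1
    funext i
    exact F.map_comp _ _

theorem hom_ext' {X Y : Fam.{w} J} {f g : Hom X Y} (h : ∀ i, f.toFun i = g.toFun i)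
    (h' : ∀ i, f.cell i ≫ eqToHom (congrArg Y.obj (h i)) = g.cell i) : f = g := by
  obtain ⟨a, b, c⟩ := f
  obtain ⟨a', b', c'⟩ := g
  obtain rfl : a = a' := funext h
  congr 1
  funext i
  simpa using h' i

end Fam

/-- If `J` is a groupoid, then so is `Fam J`: it is the slice `𝔹/J` of the groupoid `𝔹` of finite
sets and bijections. -/
noncomputable instance {J : Type uI} [Groupoid.{vI} J] : Groupoid (Fam.{w} J) :=
  Groupoid.ofIsIso (fun {X Y} f => by
    let e := Equiv.ofBijective f.toFun f.bij
    have he : ∀ y, f.toFun (e.symm y) = y := e.apply_symm_apply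
    have he' : ∀ x, e.symm (f.toFun x) = x := e.symm_apply_apply
    let g : Fam.Hom Y X := ⟨e.symm, e.symm.bijective, fun y =>
      eqToHom (congrArg Y.obj (he y).symm) ≫ inv (f.cell (e.symm y))⟩
    have key : ∀ x x' (h : x = x'), f.cell x ≫ eqToHom (congrArg (fun z => Y.obj (f.toFun z)) h) ≫
        inv (f.cell x') = eqToHom (congrArg X.obj h) := by
      rintro x _ rfl
      simp
    refine ⟨⟨g, Fam.hom_ext' he' fun x => ?_, Fam.hom_ext' he fun y => ?_⟩⟩
    · change (f.cell x ≫ eqToHom _ ≫ inv (f.cell (e.symm (f.toFun x)))) ≫ eqToHom _ = 𝟙 _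
      rw [key x _ (he' x).symm]
      simp
    · change ((eqToHom _ ≫ inv (f.cell (e.symm y))) ≫ f.cell (e.symm y)) ≫ eqToHom _ = 𝟙 _
      simp)

/-! ### Products of homotopy fibres -/

section

universe v₁ v₂ v₃ u₁ u₂ u₃

variable {X : Type u₁} {Y : Type u₂} {S : Type u₃}
variable [Category.{v₁} X] [Category.{v₂} Y] [Category.{v₃} S]

/-- For `f : X ⥤ S` and `g : Y ⥤ S`, the product `X_N × Y_N` of the homotopy fibres of `f` and `g`
over `N`. -/
abbrev ProdFibre (f : X ⥤ S) (g : Y ⥤ S) (N : S) : Type (max u₁ u₂ v₃) :=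
  CostructuredArrow f N × CostructuredArrow g N

/-- The functor `X_N × Y_N ⥤ X_N' × Y_N'` induced by an arrow `N ⟶ N'`. -/
abbrev ProdFibre.map (f : X ⥤ S) (g : Y ⥤ S) {N N' : S} (a : N ⟶ N') :
    ProdFibre f g N ⥤ ProdFibre f g N' :=
  (CostructuredArrow.map a).prod (CostructuredArrow.map a)

/-- For `f : X ⥤ S` and `g : Y ⥤ S`, the functor `N ↦ X_N × Y_N` sending `N` to the product of the
homotopy fibres of `f` and `g` over `N`. -/
def prodFibres (f : X ⥤ S) (g : Y ⥤ S) : S ⥤ Cat.{max v₁ v₂, max u₁ u₂ v₃} where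
  obj N := Cat.of.{max v₁ v₂, max u₁ u₂ v₃} (ProdFibre f g N)
  map {N N'} a := Functor.toCatHom.{max v₁ v₂, max u₁ u₂ v₃} (C := ProdFibre f g N)
    (D := ProdFibre f g N') (ProdFibre.map f g a)
  map_id N := by
    refine Cat.Hom.ext ?_
    change (((CostructuredArrow.functor f).map (𝟙 N)).toFunctor.prod
      ((CostructuredArrow.functor g).map (𝟙 N)).toFunctor) = _
    rw [(CostructuredArrow.functor f).map_id, (CostructuredArrow.functor g).map_id]
    rfl
  map_comp a b := by
    refine Cat.Hom.ext ?_
    change (((CostructuredArrow.functor f).map (a ≫ b)).toFunctor.prod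
      ((CostructuredArrow.functor g).map (a ≫ b)).toFunctor) = _
    rw [(CostructuredArrow.functor f).map_comp, (CostructuredArrow.functor g).map_comp]
    rfl

/-- The functor `X_N × Y_N ⥤ X × Y`. -/
abbrev ProdFibre.proj (f : X ⥤ S) (g : Y ⥤ S) (N : S) : ProdFibre f g N ⥤ X × Y :=
  (CostructuredArrow.proj f N).prod (CostructuredArrow.proj g N)

/-- The canonical map from the homotopy sum of the groupoids `X_N × Y_N` to `X × Y`. -/
def prodFibresProj (f : X ⥤ S) (g : Y ⥤ S) : Grothendieck (prodFibres f g) ⥤ X × Y where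
  obj Z := (ProdFibre.proj f g Z.base).obj Z.fiber
  map {_ Z'} a := (ProdFibre.proj f g Z'.base).map a.fiber
  map_id Z := by
    rw [Grothendieck.id_fiber]
    exact eqToHom_map (ProdFibre.proj f g Z.base) _
  map_comp {Z Z' Z''} a b := by
    rw [Grothendieck.comp_fiber]
    refine ((ProdFibre.proj f g Z''.base).map_comp _ _).trans ?_
    refine (congrArg₂ (· ≫ ·) (eqToHom_map (ProdFibre.proj f g Z''.base) _)
      ((ProdFibre.proj f g Z''.base).map_comp _ _)).trans ?_
    exact Category.id_comp _

end

/-! ### Polynomial endofunctors and trees -/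

/-- A diagram of groupoids `I ← E → B → I`, representing a polynomial endofunctor. -/
structure PolyEndo (I : Type uI) (E : Type uE) (B : Type uB)
    [Groupoid.{vI} I] [Groupoid.{vE} E] [Groupoid.{vB} B] where
  /-- the map `s : E → I` giving the input colours -/
  src : E ⥤ I
  /-- the map `p : E → B` whose fibres are the arities -/
  mid : E ⥤ B
  /-- the map `t : B → I` giving the output colours -/
  tgt : B ⥤ I

/-- An (operadic) tree: a diagram of finite sets `Edge ← Mark → Node → Edge` satisfying the
three tree axioms. -/
structure OpTree where
  /-- the set `A` of edges -/
  Edge : Type w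
  /-- the set `M` of nodes with a marked input edge -/
  Mark : Type w
  /-- the set `N` of nodes -/
  Node : Type w
  [finEdge : Finite Edge]
  [finMark : Finite Mark]
  [finNode : Finite Node]
  /-- the marked edge -/
  s : Mark → Edge
  /-- the node -/
  p : Mark → Node
  /-- the output edge of a node -/
  t : Node → Edge
  /-- the root edge -/
  root : Edge
  t_inj : Function.Injective t
  s_inj : Function.Injective s
  range_s : Set.range s = {root}ᶜ
  /-- Some iterate of the walk-to-the-root function, which sends `s m` to `t (p m)` and fixes
  the root, takes `x` to the root. -/
  walk_root : ∀ x, ∃ k : ℕ, (Function.extend s (t ∘ p) id)^[k] x = root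

namespace OpTree

/-- `a` is an input edge and `b` the output edge of one and the same node. -/
def Step (T : OpTree.{w}) (a b : T.Edge) : Prop := ∃ m, T.s m = a ∧ T.t (T.p m) = b

/-- The edge `a` is `e` or lies above `e`. -/
def Above (T : OpTree.{w}) (a e : T.Edge) : Prop := Relation.ReflTransGen T.Step a e

/-- A leaf is an edge that is not the output edge of any node. -/
def IsLeaf (T : OpTree.{w}) (a : T.Edge) : Prop := a ∉ Set.range T.t

theorem s_ne_root (T : OpTree.{w}) (m : T.Mark) : T.s m ≠ T.root := by
  have : T.s m ∈ Set.range T.s := ⟨m, rfl⟩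
  rw [T.range_s] at this
  exact this

theorem exists_s (T : OpTree.{w}) {a : T.Edge} (h : a ≠ T.root) : ∃ m, T.s m = a := by
  have : a ∈ Set.range T.s := by
    rw [T.range_s]
    exact h
  exact this

/-- The walk-to-the-root function. -/
noncomputable def walk (T : OpTree.{w}) : T.Edge → T.Edge := Function.extend T.s (T.t ∘ T.p) id

theorem walk_s (T : OpTree.{w}) (m : T.Mark) : T.walk (T.s m) = T.t (T.p m) :=
  T.s_inj.extend_apply _ _ _

theorem walk_at_root (T : OpTree.{w}) : T.walk T.root = T.root :=
  Function.extend_apply' _ _ _ (by rintro ⟨m, hm⟩; exact T.s_ne_root m hm)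

theorem walk_eq_of_step (T : OpTree.{w}) {a b : T.Edge} (h : T.Step a b) : T.walk a = b := by
  obtain ⟨m, rfl, rfl⟩ := h
  exact T.walk_s m

theorem Above.exists_iterate {T : OpTree.{w}} {a e : T.Edge} (h : T.Above a e) :
    ∃ k, T.walk^[k] a = e := by
  induction h with
  | refl => exact ⟨0, rfl⟩
  | tail _ hs ih =>
    obtain ⟨k, hk⟩ := ih
    exact ⟨k + 1, by rw [Function.iterate_succ_apply', hk, T.walk_eq_of_step hs]⟩

/-- No edge lies strictly above itself. -/
theorem not_above_of_step (T : OpTree.{w}) {a b : T.Edge} (h : T.Step a b) : ¬ T.Above b a := by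
  intro hba
  obtain ⟨k, hk⟩ := hba.exists_iterate
  have hcyc : T.walk^[k + 1] a = a := by
    rw [Function.iterate_succ_apply, T.walk_eq_of_step h, hk]
  obtain ⟨j, hj⟩ := T.walk_root a
  change T.walk^[j] a = T.root at hj
  have hroot : ∀ i, T.walk^[i] T.root = T.root := fun i =>
    Function.iterate_fixed T.walk_at_root i
  have h1 : T.walk^[(k + 1) * j] a = a := by
    rw [Function.iterate_mul]
    exact Function.iterate_fixed hcyc j
  have h2 : T.walk^[(k + 1) * j] a = T.root := by
    rw [show (k + 1) * j = k * j + j by ring, Function.iterate_add_apply, hj, hroot]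
  obtain ⟨m, hm, -⟩ := h
  exact T.s_ne_root m (by rw [hm, ← h1, h2])

/-- The ideal subtree generated by an edge `e`: it consists of `e` (the new root) and all the
edges and nodes above `e`. -/
def ideal (T : OpTree.{w}) (e : T.Edge) : OpTree.{w} where
  Edge := {a : T.Edge // T.Above a e}
  Mark := {m : T.Mark // T.Above (T.t (T.p m)) e}
  Node := {n : T.Node // T.Above (T.t n) e}
  finEdge := have := T.finEdge; inferInstance
  finMark := have := T.finMark; inferInstance
  finNode := have := T.finNode; inferInstance
  s m := ⟨T.s m.1, Relation.ReflTransGen.head ⟨m.1, rfl, rfl⟩ m.2⟩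
  p m := ⟨T.p m.1, m.2⟩
  t n := ⟨T.t n.1, n.2⟩
  root := ⟨e, Relation.ReflTransGen.refl⟩
  t_inj n n' h := Subtype.ext (T.t_inj (congrArg Subtype.val h))
  s_inj m m' h := Subtype.ext (T.s_inj (congrArg Subtype.val h))
  range_s := by
    ext ⟨a, ha⟩
    constructor
    · rintro ⟨m, hm⟩ h
      have hm' : T.s m.1 = e := (congrArg Subtype.val hm).trans (congrArg Subtype.val h)
      exact T.not_above_of_step ⟨m.1, hm', rfl⟩ m.2
    · intro h
      rcases Relation.ReflTransGen.cases_head ha with h' | ⟨b, ⟨m, rfl, rfl⟩, hb⟩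
      · exact absurd (Subtype.ext h') h
      · exact ⟨⟨m, hb⟩, rfl⟩
  walk_root := by
    rintro ⟨a, ha⟩
    induction ha using Relation.ReflTransGen.head_induction_on with
    | refl => exact ⟨0, rfl⟩
    | head hs hb ih =>
      obtain ⟨m, rfl, rfl⟩ := hs
      obtain ⟨k, hk⟩ := ih
      refine ⟨k + 1, ?_⟩
      rw [Function.iterate_succ_apply, ← hk]
      congr 1
      refine Function.Injective.extend_apply (f := fun m : {m : T.Mark // T.Above (T.t (T.p m)) e} =>
        (⟨T.s m.1, Relation.ReflTransGen.head ⟨m.1, rfl, rfl⟩ m.2⟩ : {a : T.Edge // T.Above a e}))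
        ?_ _ _ (⟨m, hb⟩ : {m : T.Mark // T.Above (T.t (T.p m)) e})
      exact fun m m' h => Subtype.ext (T.s_inj (congrArg Subtype.val h))

end OpTree

section

variable {I : Type uI} {E : Type uE} {B : Type uB}
variable [Groupoid.{vI} I] [Groupoid.{vE} E] [Groupoid.{vB} B]

/-- A `P`-tree: a tree with a map of diagrams to `I ← E → B → I`, whose squares commute up to
specified isomorphisms and whose middle square is (homotopy) cartesian. -/
structure PTree (P : PolyEndo I E B) extends OpTree.{w} where
  /-- the decoration of the edges -/
  edgeDec : Edge → I
  /-- the decoration of the nodes with a marked input edge -/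
  markDec : Mark → E
  /-- the decoration of the nodes -/
  nodeDec : Node → B
  /-- the 2-cell in the left-hand square -/
  sCell : ∀ m, P.src.obj (markDec m) ⟶ edgeDec (s m)
  /-- the 2-cell in the middle square -/
  pCell : ∀ m, P.mid.obj (markDec m) ⟶ nodeDec (p m)
  /-- the 2-cell in the right-hand square -/
  tCell : ∀ n, P.tgt.obj (nodeDec n) ⟶ edgeDec (t n)
  /-- The middle square is cartesian: for each node `n`, the comparison map from the (discrete)
  set of input edges of `n` to the homotopy fibre of `E → B` over the decoration of `n` is an
  equivalence of groupoids. -/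
  cart : ∀ n, (Discrete.functor (fun m : {m : Mark // p m = n} =>
    (CostructuredArrow.mk (pCell m.1 ≫ eqToHom (congrArg nodeDec m.2)) :
      CostructuredArrow P.mid (nodeDec n)))).IsEquivalence

namespace PTree

variable {P : PolyEndo I E B}

/-- A morphism of `P`-trees: a tree embedding (a map of diagrams with cartesian middle square)
together with a 2-cell over `I ← E → B → I`, compatible with the decorations. -/
@[ext]
structure Hom (S T : PTree.{w} P) where
  /-- the map on edges -/
  edge : S.Edge → T.Edge
  /-- the map on nodes with a marked input edge -/
  mark : S.Mark → T.Mark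
  /-- the map on nodes -/
  node : S.Node → T.Node
  s_comm : ∀ m, T.s (mark m) = edge (S.s m)
  p_comm : ∀ m, T.p (mark m) = node (S.p m)
  t_comm : ∀ n, T.t (node n) = edge (S.t n)
  /-- the middle square is cartesian -/
  cart : ∀ n m', T.p m' = node n → ∃! m, S.p m = n ∧ mark m = m'
  /-- the 2-cell on edges -/
  edgeCell : ∀ a, S.edgeDec a ⟶ T.edgeDec (edge a)
  /-- the 2-cell on nodes with a marked input edge -/
  markCell : ∀ m, S.markDec m ⟶ T.markDec (mark m)
  /-- the 2-cell on nodes -/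
  nodeCell : ∀ n, S.nodeDec n ⟶ T.nodeDec (node n)
  s_coh : ∀ m, S.sCell m ≫ edgeCell (S.s m) =
    P.src.map (markCell m) ≫ T.sCell (mark m) ≫ eqToHom (congrArg T.edgeDec (s_comm m))
  p_coh : ∀ m, S.pCell m ≫ nodeCell (S.p m) =
    P.mid.map (markCell m) ≫ T.pCell (mark m) ≫ eqToHom (congrArg T.nodeDec (p_comm m))
  t_coh : ∀ n, S.tCell n ≫ edgeCell (S.t n) =
    P.tgt.map (nodeCell n) ≫ T.tCell (node n) ≫ eqToHom (congrArg T.edgeDec (t_comm n))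

theorem Hom.eqToHom_edgeCell {S T : PTree.{w} P} (f : Hom S T) {a b : S.Edge} (h : a = b) :
    eqToHom (congrArg S.edgeDec h) ≫ f.edgeCell b =
      f.edgeCell a ≫ eqToHom (congrArg (fun x => T.edgeDec (f.edge x)) h) := by
  subst h; simp

theorem Hom.eqToHom_nodeCell {S T : PTree.{w} P} (f : Hom S T) {a b : S.Node} (h : a = b) :
    eqToHom (congrArg S.nodeDec h) ≫ f.nodeCell b =
      f.nodeCell a ≫ eqToHom (congrArg (fun x => T.nodeDec (f.node x)) h) := by
  subst h; simp

theorem Hom.comp_edgeCell {S T U : PTree.{w} P} (f : Hom S T) (g : Hom T U) {a : S.Edge}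
    {b : T.Edge} {c : U.Edge} (h : f.edge a = b) (h' : g.edge b = c) :
    (f.edgeCell a ≫ g.edgeCell (f.edge a)) ≫
        eqToHom (congrArg U.edgeDec ((congrArg g.edge h).trans h')) =
      (f.edgeCell a ≫ eqToHom (congrArg T.edgeDec h)) ≫
        g.edgeCell b ≫ eqToHom (congrArg U.edgeDec h') := by
  subst h; subst h'; simp

/-- The identity embedding. -/
def Hom.id (S : PTree.{w} P) : Hom S S where
  edge a := a
  mark m := m
  node n := n
  s_comm _ := rfl
  p_comm _ := rfl
  t_comm _ := rfl
  cart n m' h := ⟨m', ⟨h, rfl⟩, fun _ hy => hy.2⟩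
  edgeCell a := 𝟙 _
  markCell m := 𝟙 _
  nodeCell n := 𝟙 _
  s_coh m := by simp
  p_coh m := by simp
  t_coh n := by simp

/-- Composition of embeddings; the 2-cells are pasted. -/
def Hom.comp {S T U : PTree.{w} P} (f : Hom S T) (g : Hom T U) : Hom S U where
  edge a := g.edge (f.edge a)
  mark m := g.mark (f.mark m)
  node n := g.node (f.node n)
  s_comm m := (g.s_comm _).trans (congrArg g.edge (f.s_comm m))
  p_comm m := (g.p_comm _).trans (congrArg g.node (f.p_comm m))
  t_comm n := (g.t_comm _).trans (congrArg g.edge (f.t_comm n))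
  cart n m'' h := by
    obtain ⟨m', ⟨h1, h2⟩, h3⟩ := g.cart _ _ h
    obtain ⟨m, ⟨h4, h5⟩, h6⟩ := f.cart _ _ h1
    refine ⟨m, ⟨h4, by rw [h5, h2]⟩, ?_⟩
    rintro y ⟨hy1, hy2⟩
    exact h6 y ⟨hy1, h3 _ ⟨by rw [f.p_comm, hy1], hy2⟩⟩
  edgeCell a := f.edgeCell a ≫ g.edgeCell (f.edge a)
  markCell m := f.markCell m ≫ g.markCell (f.mark m)
  nodeCell n := f.nodeCell n ≫ g.nodeCell (f.node n)
  s_coh m := by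
    rw [← Category.assoc, f.s_coh, Category.assoc, Category.assoc,
      g.eqToHom_edgeCell (f.s_comm m), reassoc_of% (g.s_coh (f.mark m))]
    simp
  p_coh m := by
    rw [← Category.assoc, f.p_coh, Category.assoc, Category.assoc,
      g.eqToHom_nodeCell (f.p_comm m), reassoc_of% (g.p_coh (f.mark m))]
    simp
  t_coh n := by
    rw [← Category.assoc, f.t_coh, Category.assoc, Category.assoc,
      g.eqToHom_edgeCell (f.t_comm n), reassoc_of% (g.t_coh (f.node n))]
    simp

/-- The category of `P`-trees and embeddings of `P`-trees. -/
instance : Category (PTree.{w} P) where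
  Hom S T := Hom S T
  id S := Hom.id S
  comp f g := Hom.comp f g
  id_comp f := by
    cases f; simp [Hom.id, Hom.comp]
  comp_id f := by
    cases f; simp [Hom.id, Hom.comp]
  assoc f g h := by
    cases f; cases g; cases h; simp [Hom.comp]

theorem edge_of_eq {S T : PTree.{w} P} {f g : S ⟶ T} (h : f = g) (a : S.Edge) :
    f.edge a = g.edge a := by rw [h]

theorem inv_hom_edge {S T : PTree.{w} P} (e : S ≅ T) (a : S.Edge) :
    e.inv.edge (e.hom.edge a) = a := edge_of_eq e.hom_inv_id a

theorem hom_inv_edge {S T : PTree.{w} P} (e : S ≅ T) (a : T.Edge) :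
    e.hom.edge (e.inv.edge a) = a := edge_of_eq e.inv_hom_id a

/-- Isomorphisms preserve the root. -/
theorem iso_root {S T : PTree.{w} P} (e : S ≅ T) : e.hom.edge S.root = T.root := by
  by_contra h
  obtain ⟨m, hm⟩ := T.exists_s h
  refine S.s_ne_root (e.inv.mark m) ?_
  rw [e.inv.s_comm, hm, inv_hom_edge]

/-- Isomorphisms preserve leaves. -/
theorem iso_leaf {S T : PTree.{w} P} (e : S ≅ T) {a : S.Edge} (h : S.IsLeaf a) :
    T.IsLeaf (e.hom.edge a) := by
  rintro ⟨n, hn⟩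
  exact h ⟨e.inv.node n, by rw [e.inv.t_comm, hn, inv_hom_edge]⟩

theorem Hom.above {S T : PTree.{w} P} (f : Hom S T) {a e : S.Edge} (h : S.Above a e) :
    T.Above (f.edge a) (f.edge e) := by
  induction h with
  | refl => exact Relation.ReflTransGen.refl
  | tail _ hs ih =>
    obtain ⟨m, rfl, rfl⟩ := hs
    exact ih.tail ⟨f.mark m, f.s_comm m, by rw [f.p_comm, f.t_comm]⟩

/-- The ideal subtree of a `P`-tree generated by an edge `e`, with the restricted decorations. -/
def ideal (T : PTree.{w} P) (e : T.Edge) : PTree.{w} P where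
  toOpTree := T.toOpTree.ideal e
  edgeDec a := T.edgeDec a.1
  markDec m := T.markDec m.1
  nodeDec n := T.nodeDec n.1
  sCell m := T.sCell m.1
  pCell m := T.pCell m.1
  tCell n := T.tCell n.1
  cart := by
    rintro ⟨n, hn⟩
    let φ : {m : {m : T.Mark // T.Above (T.t (T.p m)) e} //
        (⟨T.p m.1, m.2⟩ : {n : T.Node // T.Above (T.t n) e}) = ⟨n, hn⟩} ≃
        {m : T.Mark // T.p m = n} :=
      { toFun := fun m => ⟨m.1.1, congrArg Subtype.val m.2⟩
        invFun := fun m => ⟨⟨m.1, by rw [m.2]; exact hn⟩, Subtype.ext m.2⟩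
        left_inv := fun _ => rfl
        right_inv := fun _ => rfl }
    have h1 := T.cart n
    have h2 : ((Discrete.equivalence φ).functor ⋙ Discrete.functor
        (fun m : {m : T.Mark // T.p m = n} =>
          (CostructuredArrow.mk (T.pCell m.1 ≫ eqToHom (congrArg T.nodeDec m.2)) :
            CostructuredArrow P.mid (T.nodeDec n)))).IsEquivalence := inferInstance
    exact @Functor.isEquivalence_of_iso _ _ _ _ _ _ (Discrete.natIso (fun m => Iso.refl _)) h2

/-- An embedding `f : S ⟶ T` restricts to an embedding of ideal subtrees. -/
def Hom.restrict {S T : PTree.{w} P} (f : S ⟶ T) (a : S.Edge) (b : T.Edge) (h : f.edge a = b) :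
    S.ideal a ⟶ T.ideal b where
  edge x := ⟨f.edge x.1, h ▸ f.above x.2⟩
  mark m := ⟨f.mark m.1, by
    rw [f.p_comm, f.t_comm, ← h]; exact f.above m.2⟩
  node n := ⟨f.node n.1, by
    rw [f.t_comm, ← h]; exact f.above n.2⟩
  s_comm m := Subtype.ext (f.s_comm m.1)
  p_comm m := Subtype.ext (f.p_comm m.1)
  t_comm n := Subtype.ext (f.t_comm n.1)
  cart := by
    rintro ⟨n, hn⟩ ⟨m', hm'⟩ hm
    obtain ⟨m, ⟨h1, h2⟩, h3⟩ := f.cart n m' (congrArg Subtype.val hm)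
    refine ⟨⟨m, by rw [h1]; exact hn⟩, ⟨Subtype.ext h1, Subtype.ext h2⟩, ?_⟩
    rintro ⟨y, hy⟩ ⟨hy1, hy2⟩
    exact Subtype.ext (h3 y ⟨congrArg Subtype.val hy1, congrArg Subtype.val hy2⟩)
  edgeCell x := f.edgeCell x.1
  markCell m := f.markCell m.1
  nodeCell n := f.nodeCell n.1
  s_coh m := f.s_coh m.1
  p_coh m := f.p_coh m.1
  t_coh n := f.t_coh n.1

theorem Hom.restrict_of_eq_id {S : PTree.{w} P} (f : S ⟶ S) (hf : f = 𝟙 S) (a : S.Edge)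
    (h : f.edge a = a) : Hom.restrict f a a h = 𝟙 (S.ideal a) := by
  subst hf; rfl

/-- An isomorphism restricts to an isomorphism of ideal subtrees. -/
def restrictIso {S T : PTree.{w} P} (e : S ≅ T) (a : S.Edge) (b : T.Edge)
    (h : e.hom.edge a = b) : S.ideal a ≅ T.ideal b where
  hom := Hom.restrict e.hom a b h
  inv := Hom.restrict e.inv b a (by rw [← h, inv_hom_edge])
  hom_inv_id := by
    exact Hom.restrict_of_eq_id _ e.hom_inv_id a (edge_of_eq e.hom_inv_id a)
  inv_hom_id := by
    exact Hom.restrict_of_eq_id _ e.inv_hom_id b (edge_of_eq e.inv_hom_id b)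

end PTree

/-! ### The groupoids of trees, forests and cuts -/

variable (P : PolyEndo I E B)

/-- The groupoid `𝐓` of `P`-trees and their isomorphisms. -/
abbrev TreeGrpd := Core (PTree.{w} P)

/-- The groupoid `𝐅` of `P`-forests, i.e. of finite families of `P`-trees. -/
abbrev ForestGrpd := Fam.{w} (TreeGrpd.{w} P)

/-- The root map `R : 𝐓 → I`. -/
def rootT : TreeGrpd.{w} P ⥤ I where
  obj T := T.of.edgeDec T.of.root
  map {_ T'} f := f.iso.hom.edgeCell _ ≫ eqToHom (congrArg T'.of.edgeDec (PTree.iso_root f.iso))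
  map_id T := by
    exact Category.id_comp (𝟙 (T.of.edgeDec T.of.root))
  map_comp f g := PTree.Hom.comp_edgeCell f.iso.hom g.iso.hom (PTree.iso_root f.iso)
    (PTree.iso_root g.iso)

/-- The leaf map `L : 𝐓 → Fam I`. -/
def leafT : TreeGrpd.{w} P ⥤ Fam.{w} I where
  obj T := { idx := {a : T.of.Edge // T.of.IsLeaf a}
             fin := have := T.of.finEdge; inferInstance
             obj := fun a => T.of.edgeDec a.1 }
  map f :=
    { toFun := fun a => ⟨f.iso.hom.edge a.1, PTree.iso_leaf f.iso a.2⟩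
      bij := by
        refine Function.bijective_iff_has_inverse.2
          ⟨fun a => ⟨f.iso.inv.edge a.1, PTree.iso_leaf f.iso.symm a.2⟩, ?_, ?_⟩
        · exact fun a => Subtype.ext (PTree.inv_hom_edge f.iso a.1)
        · exact fun a => Subtype.ext (PTree.hom_inv_edge f.iso a.1)
      cell := fun a => f.iso.hom.edgeCell a.1 }
  map_id _ := rfl
  map_comp _ _ := rfl

/-- The root map `R : 𝐅 → Fam I` of forests. -/
def rootF : ForestGrpd.{w} P ⥤ Fam.{w} I := Fam.map (rootT.{w} P)

/-- The root-preserving embeddings `c : S ⟶ T` of `P`-trees. -/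
def IsCut : ObjectProperty (Arrow (PTree.{w} P)) :=
  fun c => c.hom.edge c.left.root = c.right.root

/-- The groupoid `𝐂` of trees with a cut: objects are the root-preserving embeddings of
`P`-trees, arrows are the isomorphisms of such embeddings (commutative squares). -/
abbrev CutGrpd := Core (IsCut.{w} P).FullSubcategory

/-- The map `m : 𝐂 → 𝐓` returning the total tree `T` of a cut `c : S ⟶ T`. -/
def totalTree : CutGrpd.{w} P ⥤ TreeGrpd.{w} P := ((IsCut.{w} P).ι ⋙ Arrow.rightFunc).core

/-- The map `r : 𝐂 → 𝐓` returning the tree `S` below the cut `c : S ⟶ T`. -/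
def lowerTree : CutGrpd.{w} P ⥤ TreeGrpd.{w} P := ((IsCut.{w} P).ι ⋙ Arrow.leftFunc).core

theorem cut_square {c d : CutGrpd.{w} P} (f : c ⟶ d) (a : c.of.obj.left.Edge) :
    ((totalTree P).map f).iso.hom.edge (c.of.obj.hom.edge a) =
      d.of.obj.hom.edge (((lowerTree P).map f).iso.hom.edge a) :=
  (PTree.edge_of_eq (Arrow.w ((IsCut.{w} P).ι.map f.iso.hom)) a).symm

/-- The map `w : 𝐂 → 𝐅` returning, for a cut `c : S ⟶ T`, the forest of the ideal subtrees of `T`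
generated by the leaves of `S`. -/
def upperForest : CutGrpd.{w} P ⥤ ForestGrpd.{w} P where
  obj c :=
    { idx := {a : c.of.obj.left.Edge // c.of.obj.left.IsLeaf a}
      fin := have := c.of.obj.left.finEdge; inferInstance
      obj := fun a => ⟨c.of.obj.right.ideal (c.of.obj.hom.edge a.1)⟩ }
  map f :=
    { toFun := ((leafT P).map ((lowerTree P).map f)).toFun
      bij := ((leafT P).map ((lowerTree P).map f)).bij
      cell := fun a => ⟨PTree.restrictIso ((totalTree P).map f).iso _ _ (cut_square P f a.1)⟩ }
  map_id _ := rfl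
  map_comp _ _ := rfl

/-! ### The two sides of the equivalence -/

variable (v : I)

/-- The homotopy fibre `𝐓_v` of the root map over the colour `v`. -/
abbrev TreeGrpdAt := CostructuredArrow (rootT.{w} P) v

/-- The functor `T ↦ cut(T)`, the set of components of the homotopy fibre `_T𝐂` of `m`. -/
def cutSet : TreeGrpd.{w} P ⥤ Type _ :=
  CostructuredArrow.functor (totalTree.{w} P) ⋙ Cat.connectedComponents

/-- The homotopy sum of the homotopy fibres `_T𝐂` over `T ∈ 𝐓_v`. -/
abbrev SumCutFibres :=
  Grothendieck (CostructuredArrow.proj (rootT.{w} P) v ⋙ CostructuredArrow.functor (totalTree P))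

/-- The homotopy sum of the discrete groupoids `cut(T)` over `T ∈ 𝐓_v`. -/
abbrev SumCuts :=
  Grothendieck (CostructuredArrow.proj (rootT.{w} P) v ⋙ cutSet P ⋙ typeToCat)

/-- The map of homotopy sums induced by the canonical maps `_T𝐂 → π₀(_T𝐂) = cut(T)`. -/
def toSumCuts : SumCutFibres.{w} P v ⥤ SumCuts.{w} P v where
  obj X := ⟨X.base, ⟨Quotient.mk _ X.fiber⟩⟩
  map f := ⟨f.base, Discrete.eqToHom
    (Quotient.sound (s := Zigzag.setoid _) (Zigzag.of_hom f.fiber))⟩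
  map_id _ := Grothendieck.ext _ _ rfl (Subsingleton.elim (α := ULift (PLift _)) _ _)
  map_comp _ _ := Grothendieck.ext _ _ rfl (Subsingleton.elim (α := ULift (PLift _)) _ _)

/-- The colour of the root of `S` and that of the root of `T` agree for a cut `c : S ⟶ T`. -/
def cutRootIso (c : CutGrpd.{w} P) :
    (rootT P).obj ((lowerTree P).obj c) ⟶ (rootT P).obj ((totalTree P).obj c) :=
  c.of.obj.hom.edgeCell _ ≫ eqToHom (congrArg c.of.obj.right.edgeDec c.of.property)

theorem cutRootIso_naturality {c d : CutGrpd.{w} P} (f : c ⟶ d) :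
    (rootT P).map ((lowerTree P).map f) ≫ cutRootIso P d =
      cutRootIso P c ≫ (rootT P).map ((totalTree P).map f) := by
  have h := PTree.Hom.comp_edgeCell ((lowerTree P).map f).iso.hom d.of.obj.hom
    (PTree.iso_root ((lowerTree P).map f).iso) d.of.property
  have h' := PTree.Hom.comp_edgeCell c.of.obj.hom ((totalTree P).map f).iso.hom
    c.of.property (PTree.iso_root ((totalTree P).map f).iso)
  refine h.symm.trans (Eq.trans ?_ h')
  have key : ∀ (g g' : c.of.obj.left ⟶ d.of.obj.right) (hg : g = g')
      (h₁ : g.edge c.of.obj.left.root = d.of.obj.right.root)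
      (h₂ : g'.edge c.of.obj.left.root = d.of.obj.right.root),
      g.edgeCell _ ≫ eqToHom (congrArg d.of.obj.right.edgeDec h₁) =
        g'.edgeCell _ ≫ eqToHom (congrArg d.of.obj.right.edgeDec h₂) := by
    rintro g _ rfl _ _
    rfl
  exact key _ _ (Arrow.w ((IsCut.{w} P).ι.map f.iso.hom))
    ((congrArg d.of.obj.hom.edge (PTree.iso_root ((lowerTree P).map f).iso)).trans d.of.property)
    ((congrArg ((totalTree P).map f).iso.hom.edge c.of.property).trans
      (PTree.iso_root ((totalTree P).map f).iso))

/-- The map `(w, r)` from the homotopy sum of the homotopy fibres `_T𝐂` over `T ∈ 𝐓_v` to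
`𝐅 × 𝐓_v`, sending a cut `c : S ⟶ T` to the pair `(P_c, S)`. -/
def cutProj : SumCutFibres.{w} P v ⥤ ForestGrpd.{w} P × TreeGrpdAt.{w} P v :=
  Functor.prod'
    (Grothendieck.pre _ (CostructuredArrow.proj (rootT.{w} P) v) ⋙
      CostructuredArrow.grothendieckProj (totalTree P) ⋙ upperForest P)
    ((Grothendieck.pre _ (CostructuredArrow.proj (rootT.{w} P) v) ⋙
      CostructuredArrow.grothendieckProj (totalTree P) ⋙ lowerTree P).toCostructuredArrow
        (rootT P) v
        (fun X => cutRootIso P X.fiber.left ≫ (rootT P).map X.fiber.hom ≫ X.base.hom)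
        (fun {X Y} f => by
          have h1 : (totalTree P).map f.fiber.left ≫ Y.fiber.hom = X.fiber.hom ≫ f.base.left :=
            CostructuredArrow.w f.fiber
          have h2 : (rootT P).map f.base.left ≫ Y.base.hom = X.base.hom :=
            CostructuredArrow.w f.base
          change (rootT P).map ((lowerTree P).map f.fiber.left) ≫ cutRootIso P Y.fiber.left ≫
            (rootT P).map Y.fiber.hom ≫ Y.base.hom = _
          rw [← h2, ← Category.assoc, cutRootIso_naturality, Category.assoc]
          congr 1
          have h3 := ((rootT P).map_comp _ _).symm.trans
            ((congrArg (rootT P).map h1).trans ((rootT P).map_comp _ _))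
          exact (Category.assoc _ _ _).symm.trans
            ((congrArg (· ≫ Y.base.hom) h3).trans (Category.assoc _ _ _))))

/-- The homotopy sum of the groupoids `𝐅_N × _N𝐓_v` over `N ∈ Fam I`, where `𝐅_N` and `_N𝐓_v` are
the homotopy fibres over `N` of the root map `𝐅 → Fam I` and of the leaf map `𝐓_v → 𝐓 → Fam I`. -/
abbrev SumProdFibres :=
  Grothendieck (prodFibres (rootF.{w} P) (CostructuredArrow.proj (rootT.{w} P) v ⋙ leafT P))

/-- The canonical map from the homotopy sum of the groupoids `𝐅_N × _N𝐓_v` to `𝐅 × 𝐓_v`. -/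
def sumProdFibresProj : SumProdFibres.{w} P v ⥤ ForestGrpd.{w} P × TreeGrpdAt.{w} P v :=
  prodFibresProj _ _

end

end FaaDiBruno

/-! Two facts about a root-preserving embedding `c : S ⟶ T` carry the theorem.

Rigidity: walking up from the root shows that `c` is injective on edges, hence on nodes and marks,
hence a monomorphism. An isomorphism of cuts is therefore determined by its component on the total
tree, that is, `totalTree` is faithful. Its homotopy fibres then have at most one arrow between two
objects, so they are equivalent to their sets of components, and summing over `T` makes `q` an
equivalence (`toSumCuts_isEquivalence`).

Decomposition: `T` is `S` with the trees of `P_c` glued onto its leaves. The homotopy sum of the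
groupoids `𝐅_N × _N𝐓_v` is the homotopy pullback of `R : 𝐅 → Fam I` and `L : 𝐓_v → Fam I`, so a
functor into it is a functor to `𝐅 × 𝐓_v` together with a natural transformation between the two
composites to `Fam I`. For cuts, the functor is `c ↦ (P_c, S_c)` and the transformation `cutCell` is
inverse to the 2-cell of `c` at the leaves of `S`. The resulting functor is faithful because arrows
out of `T` are determined by their restrictions to `S` and to the ideal subtrees
(`PTree.cut_hom_ext`), full because compatible restrictions glue (`PTree.exists_cut_hom`,
`exists_cutHom`), and essentially surjective because trees can be grafted onto leaves with matching
colours (`PTree.Graft.tree`, `exists_cut`). Composing with an inverse of `q` gives the equivalence.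

Gluing rests on three observations. The nodes of `T` are partitioned by the pieces; the marks are
then partitioned too, since embeddings are cartesian; and the edges are the marks together with the
root. To keep the 2-cells under control, a `P`-tree is read as a diagram of formal coproducts over
`I`, `E` and `B`, where compatibility of cells becomes commutativity of squares and a jointly
bijective family is a coproduct cocone. -/

namespace FaaDiBruno

open Limits (FormalCoproduct)

/-! ### Formal coproducts in groupoids -/

namespace Coproduct

section

universe v₁ v₂ u₁ u₂ u

variable {J : Type u₁} [Groupoid.{v₁} J] {K : Type u₂} [Category.{v₂} K]

theorem eq_of_comp_comp_eqToHom {x y u u' u'' : J} {α : x ⟶ y} {κ : y ⟶ u} {β : y ⟶ u'}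
    (e : u = u'') (e' : u' = u'') (h : (α ≫ κ) ≫ eqToHom e = (α ≫ β) ≫ eqToHom e') :
    κ ≫ eqToHom (e.trans e'.symm) = β := by
  subst e e'
  rw [← cancel_epi α]
  simpa using h

/-- The functor induced by `F : J ⥤ K` on formal coproducts. -/
def map (F : J ⥤ K) : FormalCoproduct.{w} J ⥤ FormalCoproduct.{w} K where
  obj X := ⟨X.I, fun i => F.obj (X.obj i)⟩
  map f := ⟨f.f, fun i => F.map (f.φ i)⟩
  map_id X := FormalCoproduct.hom_ext rfl fun i => by
    simp only [eqToHom_refl, Category.comp_id]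
    exact F.map_id _
  map_comp f g := FormalCoproduct.hom_ext rfl fun i => by
    simp only [eqToHom_refl, Category.comp_id]
    exact F.map_comp _ _

variable {ι : Type u} {X : ι → FormalCoproduct.{w} J} {T U : FormalCoproduct.{w} J}

/-- A jointly bijective family of morphisms of formal coproducts in a groupoid is a coproduct. -/
theorem exists_desc (π : ∀ o, X o ⟶ T)
    (hπ : Function.Bijective fun q : Σ o, (X o).I => (π q.1).f q.2) (h : ∀ o, X o ⟶ U) :
    ∃ k : T ⟶ U, ∀ o, π o ≫ k = h o := by
  -- `σ t` is the piece and index lying over `t`; the cell at `t` undoes the cell of `π` there,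
  -- which is invertible because `J` is a groupoid.
  choose σ hσ using hπ.2
  refine ⟨⟨fun t => (h (σ t).1).f (σ t).2, fun t => eqToHom (congrArg T.obj (hσ t).symm) ≫
    inv ((π (σ t).1).φ (σ t).2) ≫ (h (σ t).1).φ (σ t).2⟩, fun o => ?_⟩
  rw [FormalCoproduct.hom_ext_iff']
  intro x
  -- The index `σ ((π o).f x)` equals `⟨o, x⟩` only propositionally, so the claim is generalised to
  -- a variable `q` before substituting.
  have key : ∀ (q : Σ o, (X o).I) (hq : q = ⟨o, x⟩)
      (ht : (π q.1).f q.2 = (π o).f x), ∃ e : (h q.1).f q.2 = (h o).f x,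
      ((π o).φ x ≫ eqToHom (congrArg T.obj ht.symm) ≫ inv ((π q.1).φ q.2) ≫ (h q.1).φ q.2) ≫
        eqToHom (congrArg U.obj e) = (h o).φ x := by
    rintro _ rfl _
    exact ⟨rfl, by simp⟩
  exact key (σ ((π o).f x)) (hπ.1 (hσ _)) (hσ _)

/-- Every index of `T` is hit, and the cell of `π` there is invertible, so it can be cancelled. -/
theorem hom_ext_of_surjective (π : ∀ o, X o ⟶ T)
    (hπ : Function.Surjective fun q : Σ o, (X o).I => (π q.1).f q.2) {k k' : T ⟶ U}
    (h : ∀ o, π o ≫ k = π o ≫ k') : k = k' := by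
  rw [FormalCoproduct.hom_ext_iff']
  intro t
  obtain ⟨⟨o, x⟩, rfl⟩ := hπ t
  obtain ⟨e, he⟩ := (FormalCoproduct.hom_ext_iff' _ _).1 (h o) x
  refine ⟨e, ?_⟩
  have he' : ((π o).φ x ≫ k.φ ((π o).f x)) ≫ eqToHom (congrArg U.obj e) =
    (π o).φ x ≫ k'.φ ((π o).f x) := he
  rw [Category.assoc] at he'
  exact (cancel_epi _).1 he'

/-- Since cells are invertible, injectivity on indices is enough for `g` to be cancellable; this
yields the monomorphisms of trees. -/
theorem eq_of_comp_eq {X : FormalCoproduct.{w} J} {f f' : X ⟶ T} {g : T ⟶ U}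
    (hg : Function.Injective g.f) (h : f ≫ g = f' ≫ g) : f = f' := by
  rw [FormalCoproduct.hom_ext_iff']
  intro x
  obtain ⟨e, he⟩ := (FormalCoproduct.hom_ext_iff' _ _).1 h x
  have e' : f.f x = f'.f x := hg e
  refine ⟨e', ?_⟩
  have he' : (f.φ x ≫ g.φ (f.f x)) ≫ eqToHom (congrArg U.obj e) = f'.φ x ≫ g.φ (f'.f x) := he
  have key : ∀ (y : T.I) (hy : f.f x = y), g.φ (f.f x) ≫ eqToHom (congrArg (fun z =>
      U.obj (g.f z)) hy) = eqToHom (congrArg T.obj hy) ≫ g.φ y := by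
    rintro _ rfl
    simp
  rw [Category.assoc, key _ e', ← Category.assoc] at he'
  exact (cancel_mono _).1 he'

end

end Coproduct

section

variable {I : Type uI} {E : Type uE} {B : Type uB}
variable [Groupoid.{vI} I] [Groupoid.{vE} E] [Groupoid.{vB} B]

namespace PTree

variable {P : PolyEndo I E B}

/-! ### Trees as diagrams of formal coproducts -/

/-- The family of edge decorations. -/
abbrev edges (T : PTree.{w} P) : FormalCoproduct.{w} I := ⟨T.Edge, T.edgeDec⟩

/-- The family of decorations of the marked input edges. -/
abbrev marks (T : PTree.{w} P) : FormalCoproduct.{w} E := ⟨T.Mark, T.markDec⟩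

/-- The family of node decorations. -/
abbrev nodes (T : PTree.{w} P) : FormalCoproduct.{w} B := ⟨T.Node, T.nodeDec⟩

/-- The left-hand square of a `P`-tree. -/
abbrev sHom (T : PTree.{w} P) : (Coproduct.map P.src).obj T.marks ⟶ T.edges := ⟨T.s, T.sCell⟩

/-- The middle square of a `P`-tree. -/
abbrev pHom (T : PTree.{w} P) : (Coproduct.map P.mid).obj T.marks ⟶ T.nodes :=
  ⟨T.p, T.pCell⟩

/-- The right-hand square of a `P`-tree. -/
abbrev tHom (T : PTree.{w} P) : (Coproduct.map P.tgt).obj T.nodes ⟶ T.edges := ⟨T.t, T.tCell⟩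

/-- The inclusion of an edge. -/
abbrev edgeHom (T : PTree.{w} P) (a : T.Edge) :
    (FormalCoproduct.incl.{w} I).obj (T.edgeDec a) ⟶ T.edges :=
  FormalCoproduct.Hom.fromIncl a (𝟙 _)

namespace Hom

variable {S T U : PTree.{w} P}

/-- The action of an embedding on edges. -/
abbrev onEdges (f : S ⟶ T) : S.edges ⟶ T.edges := ⟨f.edge, f.edgeCell⟩

/-- The action of an embedding on marked edges. -/
abbrev onMarks (f : S ⟶ T) : S.marks ⟶ T.marks := ⟨f.mark, f.markCell⟩

/-- The action of an embedding on nodes. -/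
abbrev onNodes (f : S ⟶ T) : S.nodes ⟶ T.nodes := ⟨f.node, f.nodeCell⟩

theorem comp_onEdges (f : S ⟶ T) (g : T ⟶ U) : onEdges (f ≫ g) = onEdges f ≫ onEdges g := rfl

theorem s_square (f : S ⟶ T) :
    S.sHom ≫ onEdges f = (Coproduct.map P.src).map (onMarks f) ≫ T.sHom :=
  (FormalCoproduct.hom_ext_iff' _ _).2 fun x => ⟨(f.s_comm x).symm,
    (comp_eqToHom_iff _ _ _).2 ((f.s_coh x).trans (Category.assoc _ _ _).symm)⟩

theorem p_square (f : S ⟶ T) :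
    S.pHom ≫ onNodes f = (Coproduct.map P.mid).map (onMarks f) ≫ T.pHom :=
  (FormalCoproduct.hom_ext_iff' _ _).2 fun x => ⟨(f.p_comm x).symm,
    (comp_eqToHom_iff _ _ _).2 ((f.p_coh x).trans (Category.assoc _ _ _).symm)⟩

theorem t_square (f : S ⟶ T) :
    S.tHom ≫ onEdges f = (Coproduct.map P.tgt).map (onNodes f) ≫ T.tHom :=
  (FormalCoproduct.hom_ext_iff' _ _).2 fun x => ⟨(f.t_comm x).symm,
    (comp_eqToHom_iff _ _ _).2 ((f.t_coh x).trans (Category.assoc _ _ _).symm)⟩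

/-- An embedding of `P`-trees from commutative squares of formal coproducts. -/
def ofSquares (e : S.edges ⟶ T.edges) (m : S.marks ⟶ T.marks) (n : S.nodes ⟶ T.nodes)
    (hs : S.sHom ≫ e = (Coproduct.map P.src).map m ≫ T.sHom)
    (hp : S.pHom ≫ n = (Coproduct.map P.mid).map m ≫ T.pHom)
    (ht : S.tHom ≫ e = (Coproduct.map P.tgt).map n ≫ T.tHom)
    (cart : ∀ x y, T.p y = n.f x → ∃! z, S.p z = x ∧ m.f z = y) : S ⟶ T :=
  { edge := e.f
    mark := m.f
    node := n.f
    s_comm := fun x => ((FormalCoproduct.hom_ext_iff' _ _).1 hs x).1.symm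
    p_comm := fun x => ((FormalCoproduct.hom_ext_iff' _ _).1 hp x).1.symm
    t_comm := fun x => ((FormalCoproduct.hom_ext_iff' _ _).1 ht x).1.symm
    cart := cart
    edgeCell := e.φ
    markCell := m.φ
    nodeCell := n.φ
    s_coh := fun x => ((comp_eqToHom_iff _ _ _).1
      ((FormalCoproduct.hom_ext_iff' _ _).1 hs x).2).trans (Category.assoc _ _ _)
    p_coh := fun x => ((comp_eqToHom_iff _ _ _).1
      ((FormalCoproduct.hom_ext_iff' _ _).1 hp x).2).trans (Category.assoc _ _ _)
    t_coh := fun x => ((comp_eqToHom_iff _ _ _).1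
      ((FormalCoproduct.hom_ext_iff' _ _).1 ht x).2).trans (Category.assoc _ _ _) }

theorem ext_onNodes {f g : S ⟶ T} (he : onEdges f = onEdges g) (hm : onMarks f = onMarks g)
    (hn : onNodes f = onNodes g) : f = g := by
  obtain ⟨e, m, n, _, _, _, _, ec, mc, nc, _, _, _⟩ := f
  obtain ⟨e', m', n', _, _, _, _, ec', mc', nc', _, _, _⟩ := g
  obtain ⟨rfl, h1⟩ := (FormalCoproduct.Hom.mk.injEq _ _ _ _).mp he
  obtain ⟨rfl, h2⟩ := (FormalCoproduct.Hom.mk.injEq _ _ _ _).mp hm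
  obtain ⟨rfl, h3⟩ := (FormalCoproduct.Hom.mk.injEq _ _ _ _).mp hn
  obtain rfl := eq_of_heq h1
  obtain rfl := eq_of_heq h2
  obtain rfl := eq_of_heq h3
  rfl

end Hom

/-! ### Morphisms out of a tree -/

section

variable (T : PTree.{w} P) {Y : FormalCoproduct.{w} I} {i : I}

/-- The edges of a tree, other than the root, and the root. -/
def edgeCover (j : (FormalCoproduct.incl.{w} I).obj i ⟶ T.edges) :
    ∀ b : Bool, (bif b then (Coproduct.map P.src).obj T.marks else
      (FormalCoproduct.incl.{w} I).obj i) ⟶ T.edges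
  | true => T.sHom
  | false => j

/-- This is the tree axiom that `s` is injective with the root as its complement. -/
theorem edgeCover_bijective (j : (FormalCoproduct.incl.{w} I).obj i ⟶ T.edges)
    (hj : j.f ⟨⟩ = T.root) : Function.Bijective fun q : Σ b : Bool, (bif b then
      (Coproduct.map P.src).obj T.marks else (FormalCoproduct.incl.{w} I).obj i).I =>
        (T.edgeCover j q.1).f q.2 := by
  constructor
  · rintro ⟨_ | _, x⟩ ⟨_ | _, y⟩ h
    · rfl
    · exact absurd (h.symm.trans hj) (T.s_ne_root y)
    · exact absurd (h.trans hj) (T.s_ne_root x)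
    · exact congrArg _ (T.s_inj h)
  · intro a
    by_cases ha : a = T.root
    · exact ⟨⟨false, ⟨⟩⟩, hj.trans ha.symm⟩
    · obtain ⟨m, hm⟩ := T.exists_s ha
      exact ⟨⟨true, m⟩, hm⟩

/-- The edges are the coproduct of the marks and the root, so a map out of them may be prescribed
freely on both. The root enters through an arbitrary `j`, which allows it to be reached through a
piece of the tree. -/
theorem exists_edges_desc (j : (FormalCoproduct.incl.{w} I).obj i ⟶ T.edges)
    (hj : j.f ⟨⟩ = T.root) (q : (Coproduct.map P.src).obj T.marks ⟶ Y)
    (r : (FormalCoproduct.incl.{w} I).obj i ⟶ Y) :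
    ∃ e : T.edges ⟶ Y, T.sHom ≫ e = q ∧ j ≫ e = r := by
  obtain ⟨k, hk⟩ := Coproduct.exists_desc _ (T.edgeCover_bijective j hj)
    (fun b => match b with | true => q | false => r)
  exact ⟨k, hk true, hk false⟩

theorem edges_hom_ext {e e' : T.edges ⟶ Y} (hs : T.sHom ≫ e = T.sHom ≫ e')
    (hr : T.edgeHom T.root ≫ e = T.edgeHom T.root ≫ e') : e = e' :=
  Coproduct.hom_ext_of_surjective _ (T.edgeCover_bijective (T.edgeHom T.root) rfl).2
    (fun b => match b with | true => hs | false => hr)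

end

/-! ### Gluing embeddings of the pieces of a tree -/

section

universe u

variable {ι : Type u} {D : ι → PTree.{w} P} {T U : PTree.{w} P} (d : ∀ o, D o ⟶ T)

/-- By the cartesian squares, the marks over a node of a piece correspond to the marks over its
image, so a partition of the nodes induces one of the marks. -/
theorem marks_bijective (hd : Function.Bijective fun q : Σ o, (D o).Node => (d q.1).node q.2) :
    Function.Bijective fun q : Σ o, (D o).Mark => (d q.1).mark q.2 := by
  constructor
  · rintro ⟨o, m⟩ ⟨o', m'⟩ h
    have h' : (d o).mark m = (d o').mark m' := h
    have h1 : (d o).node ((D o).p m) = (d o').node ((D o').p m') := by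
      rw [← (d o).p_comm, ← (d o').p_comm, h']
    obtain ⟨rfl, h2⟩ := Sigma.mk.inj_iff.1 (@hd.1 ⟨o, (D o).p m⟩ ⟨o', (D o').p m'⟩ h1)
    obtain ⟨z, -, hz⟩ := (d o).cart ((D o).p m) _ ((d o).p_comm m)
    rw [hz m ⟨rfl, rfl⟩, hz m' ⟨(eq_of_heq h2).symm, h'.symm⟩]
  · intro m
    obtain ⟨⟨o, n⟩, hn⟩ := hd.2 (T.p m)
    obtain ⟨z, ⟨-, hz⟩, -⟩ := (d o).cart n m hn.symm
    exact ⟨⟨o, z⟩, hz⟩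

/-- A compatible family of embeddings of pieces of a tree extends to the tree. -/
theorem exists_glue_hom (hd : Function.Bijective fun q : Σ o, (D o).Node => (d q.1).node q.2)
    (h : ∀ o, D o ⟶ U) (o₀ : ι) (hroot : (d o₀).edge (D o₀).root = T.root)
    (hr : ∀ k : T.edges ⟶ U.edges, Hom.onEdges (d o₀) ≫ k = Hom.onEdges (h o₀) →
      ∀ o, (D o).edgeHom (D o).root ≫ Hom.onEdges (d o) ≫ k =
        (D o).edgeHom (D o).root ≫ Hom.onEdges (h o)) :
    ∃ k : T ⟶ U, ∀ o, d o ≫ k = h o := by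
  have hdm := marks_bijective d hd
  obtain ⟨n, hn⟩ := Coproduct.exists_desc (fun o => Hom.onNodes (d o)) hd
    (fun o => Hom.onNodes (h o))
  obtain ⟨m, hm⟩ := Coproduct.exists_desc (fun o => Hom.onMarks (d o)) hdm
    (fun o => Hom.onMarks (h o))
  -- The left-hand square forces `e` away from the root, and the piece `o₀`, whose root is that of
  -- `T`, forces it at the root.
  obtain ⟨e, hes, her⟩ := T.exists_edges_desc
    ((D o₀).edgeHom (D o₀).root ≫ Hom.onEdges (d o₀)) hroot
    ((Coproduct.map P.src).map m ≫ U.sHom) ((D o₀).edgeHom (D o₀).root ≫ Hom.onEdges (h o₀))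
  have hs : ∀ o, (D o).sHom ≫ Hom.onEdges (d o) ≫ e = (D o).sHom ≫ Hom.onEdges (h o) := by
    intro o
    rw [← Category.assoc, Hom.s_square, Category.assoc, hes, ← Category.assoc, ← Functor.map_comp,
      hm, Hom.s_square]
  -- Non-root edges of a piece are covered by `hs`. Agreement on the piece `o₀` comes first; `hr`
  -- then supplies the roots of all pieces.
  have he : ∀ o, Hom.onEdges (d o) ≫ e = Hom.onEdges (h o) := fun o =>
    (D o).edges_hom_ext (hs o) (hr e ((D o₀).edges_hom_ext (hs o₀)
      ((Category.assoc _ _ _).symm.trans her)) o)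
  refine ⟨Hom.ofSquares e m n hes ?_ ?_ ?_, fun o => Hom.ext_onNodes ?_ ?_ ?_⟩
  · refine Coproduct.hom_ext_of_surjective
      (fun o => (Coproduct.map P.mid).map (Hom.onMarks (d o))) hdm.2 fun o => ?_
    rw [← Category.assoc, ← Hom.p_square, Category.assoc, hn,
      Hom.p_square, ← Category.assoc, ← Functor.map_comp, hm]
  · refine Coproduct.hom_ext_of_surjective
      (fun o => (Coproduct.map P.tgt).map (Hom.onNodes (d o))) hd.2 fun o => ?_
    rw [← Category.assoc, ← Hom.t_square, Category.assoc, he,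
      Hom.t_square, ← Category.assoc, ← Functor.map_comp, hn]
  · intro x y hxy
    obtain ⟨⟨o, x⟩, rfl⟩ := hd.2 x
    have hn' : ∀ z, n.f ((d o).node z) = (h o).node z := fun z =>
      ((FormalCoproduct.hom_ext_iff' _ _).1 (hn o) z).1
    have hm' : ∀ z, m.f ((d o).mark z) = (h o).mark z := fun z =>
      ((FormalCoproduct.hom_ext_iff' _ _).1 (hm o) z).1
    obtain ⟨z, ⟨hz, hz'⟩, hz''⟩ := (h o).cart x y (hxy.trans (hn' x))
    refine ⟨(d o).mark z, ⟨by rw [(d o).p_comm, hz], by rw [hm', hz']⟩, ?_⟩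
    rintro z₁ ⟨h1, h2⟩
    obtain ⟨z₂, ⟨h3, rfl⟩, -⟩ := (d o).cart x z₁ h1
    rw [hz'' z₂ ⟨h3, by rw [← hm', h2]⟩]
  · exact he o
  · exact hm o
  · exact hn o

/-- Nodes and marks are covered by the pieces; the marks determine the non-root edges through `s`,
and the piece `o₀` contains the root. -/
theorem glue_hom_ext (hd : Function.Bijective fun q : Σ o, (D o).Node => (d q.1).node q.2)
    (o₀ : ι) (hroot : (d o₀).edge (D o₀).root = T.root) {k k' : T ⟶ U}
    (h : ∀ o, d o ≫ k = d o ≫ k') : k = k' := by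
  have hm : Hom.onMarks k = Hom.onMarks k' :=
    Coproduct.hom_ext_of_surjective (fun o => Hom.onMarks (d o)) (marks_bijective d hd).2
      fun o => congrArg Hom.onMarks (h o)
  refine Hom.ext_onNodes ?_ hm ?_
  · refine Coproduct.hom_ext_of_surjective _ (T.edgeCover_bijective
      ((D o₀).edgeHom (D o₀).root ≫ Hom.onEdges (d o₀)) hroot).2
      (fun b => match b with | true => ?_ | false => ?_)
    · exact (Hom.s_square k).trans ((congrArg (fun x => (Coproduct.map P.src).map x ≫ U.sHom)
        hm).trans (Hom.s_square k').symm)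
    · change ((D o₀).edgeHom (D o₀).root ≫ Hom.onEdges (d o₀)) ≫ Hom.onEdges k =
        ((D o₀).edgeHom (D o₀).root ≫ Hom.onEdges (d o₀)) ≫ Hom.onEdges k'
      rw [Category.assoc, Category.assoc, ← Hom.comp_onEdges, h o₀, Hom.comp_onEdges]
  · exact Coproduct.hom_ext_of_surjective (fun o => Hom.onNodes (d o)) hd.2
      fun o => congrArg Hom.onNodes (h o)

end

end PTree

end

/-! ### The order on the edges of a tree -/

namespace OpTree

variable (T : OpTree.{w})

theorem above_root (a : T.Edge) : T.Above a T.root := by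
  obtain ⟨k, hk⟩ := T.walk_root a
  induction k generalizing a with
  | zero => exact hk ▸ Relation.ReflTransGen.refl
  | succ k ih =>
    by_cases ha : a = T.root
    · exact ha ▸ Relation.ReflTransGen.refl
    · obtain ⟨m, rfl⟩ := T.exists_s ha
      refine Relation.ReflTransGen.head ⟨m, rfl, rfl⟩ (ih _ ?_)
      rw [Function.iterate_succ_apply] at hk
      rwa [← T.walk_s m]

variable {T}

/-- There is only one path from `x` towards the root, and both edges lie on it. -/
theorem Above.total {x a b : T.Edge} (h : T.Above x a) (h' : T.Above x b) :
    T.Above a b ∨ T.Above b a := by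
  refine Relation.ReflTransGen.total_of_right_unique (fun x y z hy hz => ?_) h h'
  rw [← T.walk_eq_of_step hy, T.walk_eq_of_step hz]

theorem Above.eq_of_isLeaf {a l : T.Edge} (h : T.Above a l) (hl : T.IsLeaf l) : a = l := by
  rcases Relation.ReflTransGen.cases_tail h with h | ⟨_, -, m, -, hm⟩
  · exact h.symm
  · exact absurd ⟨_, hm⟩ hl

end OpTree

section

variable {I : Type uI} {E : Type uE} {B : Type uB}
variable [Groupoid.{vI} I] [Groupoid.{vE} E] [Groupoid.{vB} B]

namespace PTree

variable {P : PolyEndo I E B} {S T U : PTree.{w} P}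

namespace Hom

/-! ### Root-preserving embeddings -/

/-- Induction upwards from the root. If two non-root edges have the same image, so do the edges just
below them; these agree by induction, so both edges are inputs of one node, and the cartesian square
separates the inputs of a node. -/
theorem edge_injective (c : S ⟶ T) (hc : c.edge S.root = T.root) :
    Function.Injective c.edge := by
  intro a
  induction S.above_root a using Relation.ReflTransGen.head_induction_on with
  | refl =>
    intro b h
    by_contra hb
    obtain ⟨m, rfl⟩ := S.exists_s (Ne.symm hb)
    exact T.s_ne_root (c.mark m) (by rw [c.s_comm, ← h, hc])
  | head hs _ ih =>
    obtain ⟨m, rfl, rfl⟩ := hs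
    intro b h
    by_cases hb : b = S.root
    · exact absurd (by rw [c.s_comm, h, hb, hc]) (T.s_ne_root (c.mark m))
    · obtain ⟨m', rfl⟩ := S.exists_s hb
      rw [← c.s_comm, ← c.s_comm] at h
      have h' : c.mark m = c.mark m' := T.s_inj h
      have h1 : S.p m = S.p m' := S.t_inj (ih (by
        rw [← c.t_comm, ← c.t_comm, ← c.p_comm, ← c.p_comm, h']))
      obtain ⟨z, -, hz⟩ := c.cart (S.p m) _ (c.p_comm m)
      rw [hz m ⟨rfl, rfl⟩, hz m' ⟨h1.symm, h'.symm⟩]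

theorem node_injective_of_edge {c : S ⟶ T} (h : Function.Injective c.edge) :
    Function.Injective c.node := fun n n' hn => S.t_inj (h (by
  rw [← c.t_comm, ← c.t_comm, hn]))

theorem mark_injective_of_edge {c : S ⟶ T} (h : Function.Injective c.edge) :
    Function.Injective c.mark := fun n n' hn => S.s_inj (h (by
  rw [← c.s_comm, ← c.s_comm, hn]))

theorem mono_of_edge_injective {c : S ⟶ T} (h : Function.Injective c.edge) : Mono c :=
  ⟨fun _ _ hfg => ext_onNodes
    (Coproduct.eq_of_comp_eq (g := onEdges c) h (congrArg onEdges hfg))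
    (Coproduct.eq_of_comp_eq (g := onMarks c) (mark_injective_of_edge h) (congrArg onMarks hfg))
    (Coproduct.eq_of_comp_eq (g := onNodes c) (node_injective_of_edge h) (congrArg onNodes hfg))⟩

/-- The path from `c.edge a` to the root of `T` is the image of the path from `a` to the root of
`S`, so anything met on it can be traced back. -/
theorem above_of_above (c : S ⟶ T) (hc : c.edge S.root = T.root) {a b : S.Edge}
    (h : T.Above (c.edge a) (c.edge b)) : S.Above a b := by
  induction S.above_root a using Relation.ReflTransGen.head_induction_on with
  | refl =>
    rw [hc] at h
    rcases Relation.ReflTransGen.cases_head h with h' | ⟨_, ⟨m, hm, -⟩, -⟩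
    · rw [← c.edge_injective hc (hc.trans h')]
      exact Relation.ReflTransGen.refl
    · exact absurd hm (T.s_ne_root m)
  | head hs _ ih =>
    rcases Relation.ReflTransGen.cases_head h with h' | ⟨x, hx, hx'⟩
    · rw [c.edge_injective hc h']
      exact Relation.ReflTransGen.refl
    · refine Relation.ReflTransGen.head hs (ih ?_)
      obtain ⟨m, rfl, rfl⟩ := hs
      have h1 : T.Step (c.edge (S.s m)) (c.edge (S.t (S.p m))) :=
        ⟨c.mark m, c.s_comm m, by rw [c.p_comm, c.t_comm]⟩
      rwa [← T.walk_eq_of_step h1, T.walk_eq_of_step hx]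

/-- A root-preserving embedding that is bijective on nodes is an isomorphism. -/
theorem isIso_of_node_bijective (c : S ⟶ T) (hc : c.edge S.root = T.root)
    (h : Function.Bijective c.node) : IsIso c := by
  have hd : Function.Bijective fun q : Σ _ : Unit, S.Node => c.node q.2 :=
    h.comp (Equiv.uniqueSigma fun _ : Unit => S.Node).bijective
  -- With `S` as the only piece of `T`, the identity of `S` extends along `c` to a retraction;
  -- uniqueness of extensions makes it a two-sided inverse.
  obtain ⟨k, hk⟩ := exists_glue_hom (fun _ : Unit => c) hd (fun _ => 𝟙 S) () hc
    (fun k hk _ => congrArg (S.edgeHom S.root ≫ ·) hk)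
  refine ⟨k, hk (), glue_hom_ext (fun _ : Unit => c) hd () hc fun _ => ?_⟩
  rw [← Category.assoc, hk (), Category.id_comp, Category.comp_id]

end Hom

/-! ### Ideal subtrees -/

/-- The inclusion of an ideal subtree. -/
def idealι (T : PTree.{w} P) (e : T.Edge) : T.ideal e ⟶ T where
  edge x := x.1
  mark m := m.1
  node n := n.1
  s_comm _ := rfl
  p_comm _ := rfl
  t_comm _ := rfl
  cart n m' h := ⟨⟨m', h ▸ n.2⟩, ⟨Subtype.ext h, rfl⟩, fun _ hy => Subtype.ext hy.2⟩
  edgeCell _ := 𝟙 _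
  markCell _ := 𝟙 _
  nodeCell _ := 𝟙 _
  s_coh _ := (Category.comp_id _).trans ((congrArg₂ (· ≫ ·) (P.src.map_id _)
    (Category.comp_id _)).trans (Category.id_comp _)).symm
  p_coh _ := (Category.comp_id _).trans ((congrArg₂ (· ≫ ·) (P.mid.map_id _)
    (Category.comp_id _)).trans (Category.id_comp _)).symm
  t_coh _ := (Category.comp_id _).trans ((congrArg₂ (· ≫ ·) (P.tgt.map_id _)
    (Category.comp_id _)).trans (Category.id_comp _)).symm

instance (e : T.Edge) : Mono (T.idealι e) :=
  Hom.mono_of_edge_injective Subtype.val_injective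

theorem restrict_idealι (f : S ⟶ T) (a : S.Edge) (b : T.Edge) (h : f.edge a = b) :
    Hom.restrict f a b h ≫ T.idealι b = S.idealι a ≫ f :=
  Hom.ext_onNodes
    (FormalCoproduct.hom_ext rfl fun _ => (Category.comp_id _).trans
      ((Category.comp_id _).trans (Category.id_comp _).symm))
    (FormalCoproduct.hom_ext rfl fun _ => (Category.comp_id _).trans
      ((Category.comp_id _).trans (Category.id_comp _).symm))
    (FormalCoproduct.hom_ext rfl fun _ => (Category.comp_id _).trans
      ((Category.comp_id _).trans (Category.id_comp _).symm))

/-- An embedding factors through the ideal subtree generated by the image of the root. -/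
def Hom.toIdeal (j : S ⟶ T) (e : T.Edge) (h : j.edge S.root = e) : S ⟶ T.ideal e where
  edge x := ⟨j.edge x, h ▸ j.above (S.above_root x)⟩
  mark m := ⟨j.mark m, by rw [j.p_comm, j.t_comm, ← h]; exact j.above (S.above_root _)⟩
  node n := ⟨j.node n, by rw [j.t_comm, ← h]; exact j.above (S.above_root _)⟩
  s_comm m := Subtype.ext (j.s_comm m)
  p_comm m := Subtype.ext (j.p_comm m)
  t_comm n := Subtype.ext (j.t_comm n)
  cart n m' hm := by
    obtain ⟨m, ⟨h1, h2⟩, h3⟩ := j.cart n m'.1 (congrArg Subtype.val hm)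
    exact ⟨m, ⟨h1, Subtype.ext h2⟩, fun y hy => h3 y ⟨hy.1, congrArg Subtype.val hy.2⟩⟩
  edgeCell x := j.edgeCell x
  markCell m := j.markCell m
  nodeCell n := j.nodeCell n
  s_coh m := j.s_coh m
  p_coh m := j.p_coh m
  t_coh n := j.t_coh n

theorem Hom.toIdeal_root (j : S ⟶ T) (e : T.Edge) (h : j.edge S.root = e) :
    (Hom.toIdeal j e h).edge S.root = (T.ideal e).root := Subtype.ext h

/-- An embedding that preserves leaves is the inclusion of an ideal subtree. -/
theorem Hom.isIso_toIdeal (j : S ⟶ T) (e : T.Edge) (h : j.edge S.root = e)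
    (hl : ∀ a, S.IsLeaf a → T.IsLeaf (j.edge a)) : IsIso (Hom.toIdeal j e h) := by
  -- Since leaves go to leaves, a node of `T` sitting on an edge of `S` already belongs to `S`.
  -- Climbing from `e`, the image then contains everything above `e`.
  have hnode : ∀ (y : S.Edge) (n : T.Node), T.t n = j.edge y → ∃ n', j.node n' = n := by
    intro y n hn
    by_cases hy : S.IsLeaf y
    · exact absurd ⟨n, hn⟩ (hl y hy)
    · obtain ⟨n', rfl⟩ := not_not.1 hy
      exact ⟨n', T.t_inj (by rw [j.t_comm, hn])⟩
  have hedge : ∀ x, T.Above x e → ∃ y, j.edge y = x := by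
    intro x hx
    induction hx using Relation.ReflTransGen.head_induction_on with
    | refl => exact ⟨_, h⟩
    | head hs _ ih =>
      obtain ⟨m, rfl, rfl⟩ := hs
      obtain ⟨y, hy⟩ := ih
      obtain ⟨n, hn⟩ := hnode y _ hy.symm
      obtain ⟨z, ⟨-, rfl⟩, -⟩ := j.cart n m hn.symm
      exact ⟨S.s z, (j.s_comm z).symm⟩
  refine isIso_of_node_bijective _ (toIdeal_root j e h)
    ⟨node_injective_of_edge (edge_injective _ (toIdeal_root j e h)), ?_⟩
  rintro ⟨n, hn⟩
  obtain ⟨y, hy⟩ := hedge _ hn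
  obtain ⟨n', hn'⟩ := hnode y n hy.symm
  exact ⟨n', Subtype.ext hn'⟩

/-! ### The decomposition of a tree along a cut -/

section

variable (c : S ⟶ T)

/-- The pieces of `T` cut out by `c : S ⟶ T`: the tree `S` and the ideal subtrees generated by its
leaves. -/
def cutPiece : Option {a : S.Edge // S.IsLeaf a} → PTree.{w} P
  | none => S
  | some a => T.ideal (c.edge a.1)

/-- The embeddings of the pieces. -/
def cutPieceι : ∀ o, cutPiece c o ⟶ T
  | none => c
  | some a => T.idealι (c.edge a.1)

/-- A node is assigned to a piece by its output edge: it lies in an ideal subtree exactly when that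
edge is above a leaf of `S`, and in `S` otherwise. The order is reflected by `c` and nothing in `S`
lies strictly above a leaf, so the pieces are disjoint. -/
theorem cutPieceι_bijective (hc : c.edge S.root = T.root) :
    Function.Bijective fun q : Σ o, (cutPiece c o).Node => (cutPieceι c q.1).node q.2 := by
  have hdisj : ∀ (n : S.Node) (a : {a : S.Edge // S.IsLeaf a}),
      ¬ T.Above (T.t (c.node n)) (c.edge a.1) := by
    intro n a h
    rw [c.t_comm] at h
    exact a.2 ⟨n, (c.above_of_above hc h).eq_of_isLeaf a.2⟩
  have huniq : ∀ (x : T.Edge) (a b : {a : S.Edge // S.IsLeaf a}), T.Above x (c.edge a.1) →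
      T.Above x (c.edge b.1) → a = b := by
    intro x a b ha hb
    rcases ha.total hb with h | h
    · exact Subtype.ext ((c.above_of_above hc h).eq_of_isLeaf b.2)
    · exact Subtype.ext ((c.above_of_above hc h).eq_of_isLeaf a.2).symm
  -- Climbing from the root, one stays in `S` by the cartesian squares until a leaf of `S` is
  -- passed, and from then on above that leaf.
  have hedge : ∀ x : T.Edge, (∃ a, c.edge a = x) ∨
      ∃ a : {a : S.Edge // S.IsLeaf a}, T.Above x (c.edge a.1) := by
    intro x
    induction T.above_root x using Relation.ReflTransGen.head_induction_on with
    | refl => exact Or.inl ⟨_, hc⟩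
    | head hs _ ih =>
      rcases ih with ⟨a, rfl⟩ | ⟨a, ha⟩
      · by_cases h : S.IsLeaf a
        · exact Or.inr ⟨⟨a, h⟩, Relation.ReflTransGen.single hs⟩
        · obtain ⟨n, rfl⟩ := not_not.1 h
          obtain ⟨m, rfl, hm⟩ := hs
          obtain ⟨z, ⟨-, rfl⟩, -⟩ := c.cart n m (T.t_inj (by rw [hm, c.t_comm]))
          exact Or.inl ⟨S.s z, (c.s_comm z).symm⟩
      · exact Or.inr ⟨a, Relation.ReflTransGen.head hs ha⟩
  constructor
  · rintro ⟨_ | a, n⟩ ⟨_ | b, n'⟩ h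
    · exact congrArg _ (Hom.node_injective_of_edge (c.edge_injective hc) h)
    · have h' : c.node n = n'.1 := h
      exact absurd n'.2 (h' ▸ hdisj n b)
    · have h' : n.1 = c.node n' := h
      exact absurd n.2 (h' ▸ hdisj n' a)
    · have h' : n.1 = n'.1 := h
      obtain rfl : a = b := huniq (T.t n.1) a b n.2 (h' ▸ n'.2)
      exact congrArg _ (Subtype.ext h')
  · intro n
    rcases hedge (T.t n) with ⟨a, ha⟩ | ⟨a, ha⟩
    · by_cases h : S.IsLeaf a
      · exact ⟨⟨some ⟨a, h⟩, ⟨n, ha ▸ Relation.ReflTransGen.refl⟩⟩, rfl⟩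
      · obtain ⟨n', rfl⟩ := not_not.1 h
        exact ⟨⟨none, n'⟩, T.t_inj (by rw [← ha]; exact c.t_comm n')⟩
    · exact ⟨⟨some a, ⟨n, ha⟩⟩, rfl⟩

/-- A morphism out of `T` is determined by its restrictions along a cut. -/
theorem cut_hom_ext (hc : c.edge S.root = T.root) {k k' : T ⟶ U} (h : c ≫ k = c ≫ k')
    (h' : ∀ a : {a : S.Edge // S.IsLeaf a},
      T.idealι (c.edge a.1) ≫ k = T.idealι (c.edge a.1) ≫ k') : k = k' :=
  glue_hom_ext (cutPieceι c) (cutPieceι_bijective c hc) none hc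
    (fun o => match o with | none => h | some a => h' a)

/-- Morphisms on the two sides of a cut that agree along the cut can be glued. -/
theorem exists_cut_hom (hc : c.edge S.root = T.root) (g : S ⟶ U)
    (h : ∀ a : {a : S.Edge // S.IsLeaf a}, T.ideal (c.edge a.1) ⟶ U)
    (he : ∀ a, (h a).edge (T.ideal (c.edge a.1)).root = g.edge a.1)
    (hcell : ∀ a, (c.edgeCell a.1 ≫ (h a).edgeCell (T.ideal (c.edge a.1)).root) ≫
      eqToHom (congrArg U.edgeDec (he a)) = g.edgeCell a.1) :
    ∃ k : T ⟶ U, c ≫ k = g ∧ ∀ a, T.idealι (c.edge a.1) ≫ k = h a := by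
  obtain ⟨k, hk⟩ := exists_glue_hom (U := U) (cutPieceι c) (cutPieceι_bijective c hc)
    (fun o => match o with | none => g | some a => h a) none hc (by
      -- The root of the piece at `a` is the edge `c.edge a`, where `k` is already determined by `g`
      -- through the invertible cell of `c`; `hcell` says that `h a` has the same value.
      rintro k hk (_ | a)
      · exact congrArg (S.edgeHom S.root ≫ ·) hk
      · obtain ⟨e, he'⟩ := (FormalCoproduct.hom_ext_iff' _ _).1 hk a.1
        have e' : k.f (c.edge a.1) = g.edge a.1 := e
        have he'' : (c.edgeCell a.1 ≫ k.φ (c.edge a.1)) ≫ eqToHom (congrArg U.edgeDec e') =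
          g.edgeCell a.1 := he'
        refine (FormalCoproduct.hom_ext_iff' _ _).2 fun _ => ⟨e'.trans (he a).symm, ?_⟩
        change (𝟙 (T.edgeDec (c.edge a.1)) ≫ 𝟙 (T.edgeDec (c.edge a.1)) ≫ k.φ (c.edge a.1)) ≫
          eqToHom (congrArg U.edgeDec (e'.trans (he a).symm)) =
            𝟙 (T.edgeDec (c.edge a.1)) ≫ (h a).edgeCell (T.ideal (c.edge a.1)).root
        rw [Category.id_comp, Category.id_comp]
        refine Eq.trans ?_ (Category.id_comp _).symm
        exact Coproduct.eq_of_comp_comp_eqToHom (congrArg U.edgeDec e')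
          (congrArg U.edgeDec (he a)) (he''.trans (hcell a).symm))
  exact ⟨k, hk none, fun a => hk (some a)⟩

end

end PTree

end

section

variable {I : Type uI} {E : Type uE} {B : Type uB}
variable [Groupoid.{vI} I] [Groupoid.{vE} E] [Groupoid.{vB} B]

namespace PTree

/-! ### Grafting trees onto the leaves of a tree -/

namespace Graft

variable {P : PolyEndo I E B} (S : PTree.{w} P) (F : {a : S.Edge // S.IsLeaf a} → PTree.{w} P)

/-- The trees to be assembled: `S` and the trees to be grafted onto its leaves. -/
def piece : Option {a : S.Edge // S.IsLeaf a} → PTree.{w} P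
  | none => S
  | some a => F a

/-- The edges of the grafting: the root, and an edge for each marked input edge. -/
def edges : FormalCoproduct.{w} I :=
  ⟨Option (Σ o, (piece S F o).Mark), fun x => match x with
    | none => S.edgeDec S.root
    | some q => P.src.obj ((piece S F q.1).markDec q.2)⟩

/-- The inclusion of the non-root edges of a piece. -/
def nonRoot (o : Option {a : S.Edge // S.IsLeaf a}) :
    (Coproduct.map P.src).obj (piece S F o).marks ⟶ edges S F :=
  ⟨fun m => some ⟨o, m⟩, fun m => 𝟙 (P.src.obj ((piece S F o).markDec m))⟩

/-- Indexing edges by marks makes a quotient unnecessary: only the roots of the pieces need a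
destination. For `S` it is the new root. -/
theorem exists_lower : ∃ e : S.edges ⟶ edges S F, S.sHom ≫ e = nonRoot S F none ∧
    S.edgeHom S.root ≫ e = FormalCoproduct.Hom.fromIncl (Y := edges S F) none
      (𝟙 (S.edgeDec S.root)) :=
  S.exists_edges_desc (S.edgeHom S.root) rfl _ _

/-- The inclusion of the edges of `S`. -/
noncomputable def lower : S.edges ⟶ edges S F := (exists_lower S F).choose

variable (α : ∀ a : {a : S.Edge // S.IsLeaf a}, S.edgeDec a.1 ⟶ (F a).edgeDec (F a).root)

/-- The root of `F a` is sent to the edge representing the leaf `a`; `inv (α a)` passes from its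
colour to that of `a`. -/
theorem exists_upper (a : {a : S.Edge // S.IsLeaf a}) : ∃ e : (F a).edges ⟶ edges S F,
    (F a).sHom ≫ e = nonRoot S F (some a) ∧ (F a).edgeHom (F a).root ≫ e =
      FormalCoproduct.Hom.fromIncl ((lower S F).f a.1) (inv (α a) ≫ (lower S F).φ a.1) :=
  (F a).exists_edges_desc ((F a).edgeHom (F a).root) rfl _ _

/-- The inclusion of the edges of a piece. -/
noncomputable def emb : ∀ o, (piece S F o).edges ⟶ edges S F
  | none => lower S F
  | some a => (exists_upper S F α a).choose

theorem sHom_emb : ∀ o, (piece S F o).sHom ≫ emb S F α o = nonRoot S F o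
  | none => (exists_lower S F).choose_spec.1
  | some a => (exists_upper S F α a).choose_spec.1

theorem emb_s (o) (m : (piece S F o).Mark) :
    (emb S F α o).f ((piece S F o).s m) = some ⟨o, m⟩ :=
  ((FormalCoproduct.hom_ext_iff' _ _).1 (sHom_emb S F α o) m).1

theorem emb_none_root : (emb S F α none).f S.root = none :=
  ((FormalCoproduct.hom_ext_iff' _ _).1 (exists_lower S F).choose_spec.2 ⟨⟩).1

theorem emb_some_root (a : {a : S.Edge // S.IsLeaf a}) :
    (emb S F α (some a)).f (F a).root = (emb S F α none).f a.1 :=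
  ((FormalCoproduct.hom_ext_iff' _ _).1 (exists_upper S F α a).choose_spec.2 ⟨⟩).1

theorem emb_some_root_cell (a : {a : S.Edge // S.IsLeaf a}) :
    (emb S F α (some a)).φ (F a).root ≫
      eqToHom (congrArg (edges S F).obj (emb_some_root S F α a)) =
        inv (α a) ≫ (emb S F α none).φ a.1 := by
  obtain ⟨_, h⟩ := (FormalCoproduct.hom_ext_iff' _ _).1 (exists_upper S F α a).choose_spec.2 ⟨⟩
  exact (congrArg (· ≫ _) (Category.id_comp _).symm).trans h

theorem emb_none_injective : Function.Injective (emb S F α none).f := by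
  intro x y h
  by_cases hx : x = S.root
  · by_cases hy : y = S.root
    · rw [hx, hy]
    · obtain ⟨m, rfl⟩ := S.exists_s hy
      rw [hx, emb_none_root] at h
      exact absurd (h.trans (emb_s S F α none m)) (by simp)
  · obtain ⟨m, rfl⟩ := S.exists_s hx
    by_cases hy : y = S.root
    · rw [hy, emb_none_root] at h
      exact absurd (h.symm.trans (emb_s S F α none m)) (by simp)
    · obtain ⟨m', rfl⟩ := S.exists_s hy
      cases ((emb_s S F α none m).symm.trans h).trans (emb_s S F α none m')
      rfl

theorem emb_none_ne (x : S.Edge) (a : {a : S.Edge // S.IsLeaf a}) (m : (F a).Mark) :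
    (emb S F α none).f x ≠ some ⟨some a, m⟩ := by
  intro h
  by_cases hx : x = S.root
  · rw [hx, emb_none_root] at h
    cases h
  · obtain ⟨m', rfl⟩ := S.exists_s hx
    cases (emb_s S F α none m').symm.trans h

/-- Edges of the pieces are only identified along the leaves of `S`. -/
theorem emb_eq {x y : Σ o, (piece S F o).Edge}
    (h : (emb S F α x.1).f x.2 = (emb S F α y.1).f y.2) : x = y ∨
    (∃ a, x = ⟨some a, (F a).root⟩ ∧ y = ⟨none, a.1⟩) ∨
    (∃ a, y = ⟨some a, (F a).root⟩ ∧ x = ⟨none, a.1⟩) := by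
  have key : ∀ (x : S.Edge) (a : {a : S.Edge // S.IsLeaf a}) (y : (F a).Edge),
      (emb S F α none).f x = (emb S F α (some a)).f y → y = (F a).root ∧ x = a.1 := by
    intro x a y h
    by_cases hy : y = (F a).root
    · refine ⟨hy, emb_none_injective S F α ?_⟩
      rw [h, hy, emb_some_root]
    · obtain ⟨m, rfl⟩ := (F a).exists_s hy
      exact absurd (h.trans (emb_s S F α (some a) m)) (emb_none_ne S F α x a m)
  obtain ⟨_ | a, x⟩ := x <;> obtain ⟨_ | b, y⟩ := y
  · exact Or.inl (congrArg _ (emb_none_injective S F α h))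
  · obtain ⟨rfl, rfl⟩ := key x b y h
    exact Or.inr (Or.inr ⟨b, rfl, rfl⟩)
  · obtain ⟨rfl, rfl⟩ := key y a x h.symm
    exact Or.inr (Or.inl ⟨a, rfl, rfl⟩)
  · left
    by_cases hx : x = (F a).root
    · have h' : (emb S F α none).f a.1 = (emb S F α (some b)).f y := by
        rw [← emb_some_root, ← hx]
        exact h
      obtain ⟨rfl, hb⟩ := key _ _ _ h'
      obtain rfl : a = b := Subtype.ext hb
      rw [hx]
    · by_cases hy : y = (F b).root
      · have h' : (emb S F α none).f b.1 = (emb S F α (some a)).f x := by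
          rw [← emb_some_root, ← hy]
          exact h.symm
        exact absurd (key _ _ _ h').1 hx
      · obtain ⟨m, rfl⟩ := (F a).exists_s hx
        obtain ⟨m', rfl⟩ := (F b).exists_s hy
        cases ((emb_s S F α (some a) m).symm.trans h).trans (emb_s S F α (some b) m')
        rfl

/-- The underlying tree of a grafting. -/
noncomputable def opTree : OpTree.{w} where
  Edge := (edges S F).I
  Mark := Σ o, (piece S F o).Mark
  Node := Σ o, (piece S F o).Node
  finEdge := by
    have := S.finEdge
    have := fun o => (piece S F o).finMark
    exact inferInstanceAs (Finite (Option (Σ o, (piece S F o).Mark)))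
  finMark := by
    have := S.finEdge
    have := fun o => (piece S F o).finMark
    infer_instance
  finNode := by
    have := S.finEdge
    have := fun o => (piece S F o).finNode
    infer_instance
  s := some
  p m := ⟨m.1, (piece S F m.1).p m.2⟩
  t n := (emb S F α n.1).f ((piece S F n.1).t n.2)
  root := none
  t_inj := by
    rintro ⟨o, n⟩ ⟨o', n'⟩ h
    -- Edges are identified only at leaves of `S`, and no output edge of a node is such a leaf
    -- within `S`; so outputs of distinct nodes stay distinct.
    have hl : ∀ (o : Option {a : S.Edge // S.IsLeaf a}) (n : (piece S F o).Node)
        (a : {a : S.Edge // S.IsLeaf a}),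
        (⟨o, (piece S F o).t n⟩ : Σ o, (piece S F o).Edge) ≠ ⟨none, a.1⟩ := by
      rintro (_ | _) n a h
      · exact a.2 ⟨n, eq_of_heq (Sigma.mk.inj_iff.1 h).2⟩
      · cases (Sigma.mk.inj_iff.1 h).1
    rcases emb_eq S F α (x := ⟨o, (piece S F o).t n⟩) (y := ⟨o', (piece S F o').t n'⟩) h with
      h | ⟨a, -, h⟩ | ⟨a, -, h⟩
    · obtain ⟨rfl, h⟩ := Sigma.mk.inj_iff.1 h
      rw [(piece S F o).t_inj (eq_of_heq h)]
    · exact absurd h (hl _ _ _)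
    · exact absurd h (hl _ _ _)
  s_inj := Option.some_injective _
  range_s := Set.ext fun x => by
    cases x with
    | none => exact ⟨fun ⟨m, hm⟩ => absurd hm (Option.some_ne_none m), fun h => absurd rfl h⟩
    | some m => exact ⟨fun _ => Option.some_ne_none m, fun _ => ⟨m, rfl⟩⟩
  walk_root := by
    let W : (edges S F).I → (edges S F).I :=
      Function.extend (some : (Σ o, (piece S F o).Mark) → (edges S F).I)
        (fun m => (emb S F α m.1).f ((piece S F m.1).t ((piece S F m.1).p m.2))) id
    have hstep : ∀ o (m : (piece S F o).Mark),
        (∃ k, W^[k] ((emb S F α o).f ((piece S F o).t ((piece S F o).p m))) = none) →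
        ∃ k, W^[k] (some ⟨o, m⟩) = none := by
      rintro o m ⟨k, hk⟩
      refine ⟨k + 1, (Function.iterate_succ_apply W k _).trans ((congrArg W^[k] ?_).trans hk)⟩
      exact (Option.some_injective _).extend_apply _ _ (⟨o, m⟩ : Σ o, (piece S F o).Mark)
    have hpiece : ∀ o, (∃ k, W^[k] ((emb S F α o).f (piece S F o).root) = none) →
        ∀ x, ∃ k, W^[k] ((emb S F α o).f x) = none := by
      intro o ho x
      induction (piece S F o).above_root x using Relation.ReflTransGen.head_induction_on with
      | refl => exact ho
      | head hs _ ih =>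
        obtain ⟨m, rfl, rfl⟩ := hs
        rw [emb_s]
        exact hstep o m ih
    -- Within a grafted tree the walk reaches its root, which is a leaf of `S`; from there it
    -- continues inside `S`.
    have hall : ∀ o x, ∃ k, W^[k] ((emb S F α o).f x) = none := by
      have h0 := hpiece none ⟨0, emb_none_root S F α⟩
      rintro (_ | a)
      · exact h0
      · refine hpiece (some a) ?_
        obtain ⟨k, hk⟩ := h0 a.1
        exact ⟨k, (congrArg _ (emb_some_root S F α a)).trans hk⟩
    rintro (_ | ⟨o, m⟩)
    · exact ⟨0, rfl⟩
    · exact hstep o m (hall o _)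

/-- The tree obtained from `S` by grafting the tree `F a` onto each leaf `a`. -/
noncomputable def tree : PTree.{w} P where
  toOpTree := opTree S F α
  edgeDec := (edges S F).obj
  markDec m := (piece S F m.1).markDec m.2
  nodeDec n := (piece S F n.1).nodeDec n.2
  sCell m := 𝟙 (P.src.obj ((piece S F m.1).markDec m.2))
  pCell m := (piece S F m.1).pCell m.2
  tCell n := (piece S F n.1).tCell n.2 ≫ (emb S F α n.1).φ ((piece S F n.1).t n.2)
  cart := by
    rintro ⟨o, n⟩
    -- The inputs of a node in the grafting are its inputs in its own piece, so the cartesian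
    -- condition is inherited.
    let ψ : {m : (piece S F o).Mark // (piece S F o).p m = n} →
        {m : Σ o, (piece S F o).Mark // (⟨m.1, (piece S F m.1).p m.2⟩ :
          Σ o, (piece S F o).Node) = ⟨o, n⟩} := fun m => ⟨⟨o, m.1⟩, congrArg _ m.2⟩
    have hψ : Function.Bijective ψ := by
      constructor
      · rintro ⟨m, hm⟩ ⟨m', hm'⟩ h
        have h' := congrArg Subtype.val h
        exact Subtype.ext (eq_of_heq (Sigma.mk.inj_iff.1 h').2)
      · rintro ⟨⟨o', m⟩, h⟩
        cases h
        exact ⟨⟨m, rfl⟩, rfl⟩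
    have h1 := (piece S F o).cart n
    refine @Functor.isEquivalence_of_comp_left _ _ _ _ _ _
      (Discrete.equivalence (Equiv.ofBijective ψ hψ)).functor _ inferInstance ?_
    refine @Functor.isEquivalence_of_iso _ _ _ _ _ _ (Discrete.natIso fun m => ?_) h1
    exact Iso.refl _

/-- The embedding of a piece in the grafting. -/
noncomputable def ι (o) : piece S F o ⟶ tree S F α :=
  Hom.ofSquares (T := tree S F α) (emb S F α o)
    ⟨fun m => ⟨o, m⟩, fun m => 𝟙 ((piece S F o).markDec m)⟩
    ⟨fun n => ⟨o, n⟩, fun n => 𝟙 ((piece S F o).nodeDec n)⟩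
    ((sHom_emb S F α o).trans (FormalCoproduct.hom_ext rfl fun m =>
      (Category.comp_id _).trans ((congrArg (· ≫ 𝟙 (P.src.obj ((piece S F o).markDec m)))
        (P.src.map_id ((piece S F o).markDec m))).trans (Category.id_comp _)).symm))
    (FormalCoproduct.hom_ext rfl fun m => (Category.comp_id _).trans
      ((Category.comp_id _).trans ((congrArg (· ≫ (piece S F o).pCell m)
        (P.mid.map_id ((piece S F o).markDec m))).trans (Category.id_comp _)).symm))
    (FormalCoproduct.hom_ext rfl fun n => (Category.comp_id _).trans
      ((congrArg (· ≫ (piece S F o).tCell n ≫ (emb S F α o).φ ((piece S F o).t n))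
        (P.tgt.map_id ((piece S F o).nodeDec n))).trans (Category.id_comp _)).symm)
    (by
      rintro n ⟨o', m⟩ h
      cases h
      exact ⟨m, ⟨rfl, rfl⟩, fun y hy => eq_of_heq (Sigma.mk.inj_iff.1 hy.2).2⟩)

/-- Needed to recognise `F a` as a full ideal subtree of the grafting. The delicate case is a
trivial `F a`: its leaf is its root, glued to `a`, and `a` carries no node of `S`. -/
theorem ι_isLeaf (a : {a : S.Edge // S.IsLeaf a}) (x : (F a).Edge) (hx : (F a).IsLeaf x) :
    (tree S F α).IsLeaf ((ι S F α (some a)).edge x) := by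
  rintro ⟨⟨o, n⟩, h⟩
  rcases emb_eq S F α (x := ⟨o, (piece S F o).t n⟩) (y := ⟨some a, x⟩) h with
    h | ⟨b, -, h⟩ | ⟨b, h, h'⟩
  · obtain ⟨rfl, h⟩ := Sigma.mk.inj_iff.1 h
    exact hx ⟨n, eq_of_heq h⟩
  · cases (Sigma.mk.inj_iff.1 h).1
  · obtain ⟨rfl, h'⟩ := Sigma.mk.inj_iff.1 h'
    exact b.2 ⟨n, eq_of_heq h'⟩

end Graft

end PTree

end

/-! ### Functors into a homotopy sum of products of homotopy fibres -/

section

universe v₁ v₂ v₃ v₄ u₁ u₂ u₃ u₄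

variable {X : Type u₁} {Y : Type u₂} {S : Type u₃} {A : Type u₄}
variable [Category.{v₁} X] [Category.{v₂} Y] [Groupoid.{v₃} S] [Category.{v₄} A]
variable {f : X ⥤ S} {g : Y ⥤ S}

namespace ProdFibres

/-- The components of an object of the homotopy sum. -/
abbrev fib (Z : Grothendieck (prodFibres f g)) : ProdFibre f g Z.base := Z.fiber

theorem w_fst {Z W : Grothendieck (prodFibres f g)} (u : Z ⟶ W) :
    f.map ((prodFibresProj f g).map u).1 ≫ (fib W).1.hom = (fib Z).1.hom ≫ u.base :=
  CostructuredArrow.w (Prod.fst u.fiber :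
    (CostructuredArrow.map u.base).obj (fib Z).1 ⟶ (fib W).1)

theorem w_snd {Z W : Grothendieck (prodFibres f g)} (u : Z ⟶ W) :
    g.map ((prodFibresProj f g).map u).2 ≫ (fib W).2.hom = (fib Z).2.hom ≫ u.base :=
  CostructuredArrow.w (Prod.snd u.fiber :
    (CostructuredArrow.map u.base).obj (fib Z).2 ⟶ (fib W).2)

/-- In a groupoid `S` the base component is forced by the second leg. The homotopy sum thus behaves
as the homotopy pullback of `f` and `g`. -/
theorem hom_ext {Z W : Grothendieck (prodFibres f g)} {u u' : Z ⟶ W}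
    (h : (prodFibresProj f g).map u = (prodFibresProj f g).map u') : u = u' := by
  have hb : u.base = u'.base := by
    rw [← cancel_epi (fib Z).2.hom, ← w_snd, ← w_snd, h]
  obtain ⟨b, u⟩ := u
  obtain ⟨b', u'⟩ := u'
  obtain rfl : b = b' := hb
  have : u = u' := Prod.ext
    (CostructuredArrow.hom_ext _ _ (congrArg Prod.fst h))
    (CostructuredArrow.hom_ext _ _ (congrArg Prod.snd h))
  rw [this]

/-- A morphism of the homotopy sum. -/
def homMk {Z W : Grothendieck (prodFibres f g)} (b : Z.base ⟶ W.base)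
    (p : (fib Z).1.left ⟶ (fib W).1.left) (q : (fib Z).2.left ⟶ (fib W).2.left)
    (hp : f.map p ≫ (fib W).1.hom = (fib Z).1.hom ≫ b)
    (hq : g.map q ≫ (fib W).2.hom = (fib Z).2.hom ≫ b) : Z ⟶ W where
  base := b
  fiber := ((CostructuredArrow.homMk p hp : (CostructuredArrow.map b).obj (fib Z).1 ⟶ (fib W).1),
    (CostructuredArrow.homMk q hq : (CostructuredArrow.map b).obj (fib Z).2 ⟶ (fib W).2))

theorem map_inv_comp {C : Type u₁} [Category.{v₁} C] (F : C ⥤ S) {x y : C} {s t : S}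
    {p : x ⟶ y} [IsIso p] {a : F.obj x ⟶ s} {b : F.obj y ⟶ t} {c : s ⟶ t} (h : F.map p ≫ b = a ≫ c) :
    F.map (inv p) ≫ a = b ≫ inv c := by
  rw [Functor.map_inv, IsIso.inv_comp_eq, ← Category.assoc, h]
  simp

theorem isIso {Z W : Grothendieck (prodFibres f g)} (u : Z ⟶ W)
    (hp : IsIso ((prodFibresProj f g).map u).1) (hq : IsIso ((prodFibresProj f g).map u).2) :
    IsIso u := by
  let p : (fib Z).1.left ⟶ (fib W).1.left := ((prodFibresProj f g).map u).1
  let q : (fib Z).2.left ⟶ (fib W).2.left := ((prodFibresProj f g).map u).2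
  have : IsIso p := hp
  have : IsIso q := hq
  refine ⟨homMk (inv u.base) (inv p) (inv q) (map_inv_comp f (w_fst u)) (map_inv_comp g (w_snd u)),
    hom_ext ?_, hom_ext ?_⟩
  · rw [(prodFibresProj f g).map_comp, (prodFibresProj f g).map_id]
    exact Prod.ext (IsIso.hom_inv_id p) (IsIso.hom_inv_id q)
  · rw [(prodFibresProj f g).map_comp, (prodFibresProj f g).map_id]
    exact Prod.ext (IsIso.inv_hom_id p) (IsIso.inv_hom_id q)

variable (K : A ⥤ X × Y) (θ : ∀ a, f.obj (K.obj a).1 ⟶ g.obj (K.obj a).2)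
  (hθ : ∀ {a b : A} (h : a ⟶ b), f.map (K.map h).1 ≫ θ b = θ a ≫ g.map (K.map h).2)

/-- The action on objects of the lift of a functor to `X × Y` along the projection from the
homotopy sum. -/
abbrev liftObj (a : A) : Grothendieck (prodFibres f g) :=
  ⟨g.obj (K.obj a).2, ((CostructuredArrow.mk (θ a), CostructuredArrow.mk (𝟙 _)) :
    ProdFibre f g (g.obj (K.obj a).2))⟩

/-- The lift of a functor to `X × Y` along the projection from the homotopy sum. -/
def lift : A ⥤ Grothendieck (prodFibres f g) where
  obj := liftObj K θ
  map {a b} h := homMk (Z := liftObj K θ a) (W := liftObj K θ b) (g.map (K.map h).2) (K.map h).1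
    (K.map h).2 (hθ h) ((Category.comp_id _).trans (Category.id_comp _).symm)
  map_id a := hom_ext ((K.map_id a).trans ((prodFibresProj f g).map_id (liftObj K θ a)).symm)
  map_comp {a b c} h h' := hom_ext ((K.map_comp h h').trans
    ((prodFibresProj f g).map_comp (X := liftObj K θ a) (Y := liftObj K θ b) (Z := liftObj K θ c)
      (homMk _ _ _ _ _) (homMk _ _ _ _ _)).symm)

/-- The hypotheses compare `A` with the homotopy pullback, whose objects are triples `(x, y, α :
f.obj x ⟶ g.obj y)` and whose arrows are pairs compatible with `α`. -/
theorem lift_isEquivalence (hf : K.Faithful)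
    (hfull : ∀ (a b : A) (p : (K.obj a).1 ⟶ (K.obj b).1) (q : (K.obj a).2 ⟶ (K.obj b).2),
      f.map p ≫ θ b = θ a ≫ g.map q → ∃ h : a ⟶ b, (K.map h).1 = p ∧ (K.map h).2 = q)
    (hes : ∀ (x : X) (y : Y) (α : f.obj x ⟶ g.obj y), ∃ (a : A) (p : (K.obj a).1 ⟶ x)
      (q : (K.obj a).2 ⟶ y), IsIso p ∧ IsIso q ∧ f.map p ≫ α = θ a ≫ g.map q) :
    (lift K θ hθ).IsEquivalence where
  faithful := ⟨fun {a b} h h' hh => K.map_injective (congrArg (prodFibresProj f g).map hh)⟩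
  full := ⟨fun {a b} u => by
    have hb : g.map ((prodFibresProj f g).map u).2 = u.base :=
      (Category.comp_id _).symm.trans ((w_snd u).trans (Category.id_comp _))
    obtain ⟨h, h1, h2⟩ := hfull a b ((prodFibresProj f g).map u).1 ((prodFibresProj f g).map u).2
      ((w_fst u).trans (congrArg (θ a ≫ ·) hb.symm))
    exact ⟨h, hom_ext (Prod.ext h1 h2)⟩⟩
  essSurj := ⟨fun Z => by
    -- Eliminating the base `N` turns the two legs over `N` into one arrow from `f` to `g`.
    obtain ⟨a, p, q, hp', hq', h⟩ := hes _ _ ((fib Z).1.hom ≫ inv (fib Z).2.hom)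
    have hp : f.map p ≫ (fib Z).1.hom = θ a ≫ g.map q ≫ (fib Z).2.hom := by
      rw [← Category.assoc, ← h]
      simp
    let u : (lift K θ hθ).obj a ⟶ Z := homMk (g.map q ≫ (fib Z).2.hom) p q hp
      (Category.id_comp _).symm
    have := isIso u hp' hq'
    exact ⟨a, ⟨asIso u⟩⟩⟩

/-- The lift lies over `X × Y`. -/
def liftProj : lift K θ hθ ⋙ prodFibresProj f g ≅ K :=
  NatIso.ofComponents (fun a => Iso.refl (K.obj a))
    (fun h => (Category.comp_id (K.map h)).trans (Category.id_comp (K.map h)).symm)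

end ProdFibres

/-! ### Iterated homotopy fibres -/

namespace FibreSum

variable {G : Type u₁} [Groupoid.{v₁} G] {m : A ⥤ G} {r : G ⥤ S} {v : S}

/-- The fibre component of an object of the homotopy sum. -/
abbrev fib (Z : Grothendieck (CostructuredArrow.proj r v ⋙ CostructuredArrow.functor m)) :
    CostructuredArrow m Z.base.left := Z.fiber

/-- The morphism of `A` underlying a morphism of the homotopy sum. -/
abbrev left {Z W : Grothendieck (CostructuredArrow.proj r v ⋙ CostructuredArrow.functor m)}
    (u : Z ⟶ W) : (fib Z).left ⟶ (fib W).left :=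
  CommaMorphism.left (u.fiber : (CostructuredArrow.map u.base.left).obj (fib Z) ⟶ fib W)

theorem w {Z W : Grothendieck (CostructuredArrow.proj r v ⋙ CostructuredArrow.functor m)}
    (u : Z ⟶ W) : m.map (left u) ≫ (fib W).hom = (fib Z).hom ≫ u.base.left :=
  CostructuredArrow.w (u.fiber : (CostructuredArrow.map u.base.left).obj (fib Z) ⟶ fib W)

theorem hom_ext {Z W : Grothendieck (CostructuredArrow.proj r v ⋙ CostructuredArrow.functor m)}
    {u u' : Z ⟶ W} (h : left u = left u') : u = u' := by
  have hb : u.base = u'.base := CostructuredArrow.hom_ext _ _ (by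
    rw [← cancel_epi (fib Z).hom, ← w, ← w, h])
  obtain ⟨b, u⟩ := u
  obtain ⟨b', u'⟩ := u'
  obtain rfl : b = b' := hb
  have : u = u' := CostructuredArrow.hom_ext _ _ h
  rw [this]

/-- The base arrow is forced by `φ`, and the hypothesis says that it lies over `v`. The homotopy sum
thus behaves as the homotopy fibre of `m ⋙ r` over `v`. -/
theorem exists_hom (Z W : Grothendieck (CostructuredArrow.proj r v ⋙ CostructuredArrow.functor m))
    (φ : (fib Z).left ⟶ (fib W).left) (h : r.map (m.map φ) ≫ r.map (fib W).hom ≫ W.base.hom =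
      r.map (fib Z).hom ≫ Z.base.hom) : ∃ u : Z ⟶ W, left u = φ := by
  let b : Z.base ⟶ W.base := CostructuredArrow.homMk (inv (fib Z).hom ≫ m.map φ ≫ (fib W).hom) (by
    rw [r.map_comp, r.map_comp, Category.assoc, Category.assoc, h, ← Category.assoc,
      ← r.map_comp, IsIso.inv_hom_id, r.map_id, Category.id_comp])
  have hb : m.map φ ≫ (fib W).hom = (fib Z).hom ≫ b.left := by
    simp [b]
  exact ⟨⟨b, (CostructuredArrow.homMk φ hb :
    (CostructuredArrow.map b.left).obj (fib Z) ⟶ fib W)⟩, rfl⟩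

end FibreSum

end

section

variable {I : Type uI} {E : Type uE} {B : Type uB}
variable [Groupoid.{vI} I] [Groupoid.{vE} E] [Groupoid.{vB} B]

namespace PTree

variable {P : PolyEndo I E B}

theorem edgeCell_of_eq {S T : PTree.{w} P} {f g : S ⟶ T} (h : f = g) (a : S.Edge) :
    f.edgeCell a ≫ eqToHom (congrArg T.edgeDec (edge_of_eq h a)) = g.edgeCell a := by
  subst h
  simp

/-- The inverse of the cell of a morphism of trees at an edge. -/
noncomputable abbrev Hom.invCell {S T : PTree.{w} P} (f : S ⟶ T) (a : S.Edge) :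
    T.edgeDec (f.edge a) ⟶ S.edgeDec a := inv (f.edgeCell a)

/-- Two ways of saying that a square of cells over a morphism of trees commutes. -/
theorem Hom.cell_square_iff {S T : PTree.{w} P} (f : S ⟶ T) {x x' : I} {y z : S.Edge} {t : T.Edge}
    (hy : y = z) (ht : t = f.edge y) (e : T.edgeDec t = T.edgeDec (f.edge z)) {α : x ⟶ x'}
    {β : x' ⟶ T.edgeDec t} {γ : x ⟶ S.edgeDec z} :
    ((β ≫ eqToHom (congrArg T.edgeDec ht)) ≫ inv (f.edgeCell y)) ≫
      eqToHom (congrArg S.edgeDec hy) = inv α ≫ γ ↔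
    (α ≫ β) ≫ eqToHom e = γ ≫ f.edgeCell z := by
  subst hy ht
  simp only [eqToHom_refl, Category.comp_id]
  rw [IsIso.comp_inv_eq, Category.assoc, IsIso.eq_inv_comp]

end PTree

/-! ### Cuts are determined by, and can be glued from, their two layers -/

section

variable {P : PolyEndo I E B}

/-- The embedding underlying an arrow between the lower trees of two cuts. -/
abbrev CutGrpd.lower {c d : CutGrpd.{w} P} (q : (lowerTree P).obj c ⟶ (lowerTree P).obj d) :
    c.of.obj.left ⟶ d.of.obj.left := q.iso.hom

/-- The embedding underlying an arrow between the total trees of two cuts. -/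
abbrev CutGrpd.total {c d : CutGrpd.{w} P} (q : (totalTree P).obj c ⟶ (totalTree P).obj d) :
    c.of.obj.right ⟶ d.of.obj.right := q.iso.hom

theorem CutGrpd.hom_ext {c d : CutGrpd.{w} P} {φ φ' : c ⟶ d}
    (hl : (lowerTree P).map φ = (lowerTree P).map φ')
    (hr : (totalTree P).map φ = (totalTree P).map φ') : φ = φ' := by
  refine Core.hom_ext (ObjectProperty.hom_ext _ ?_)
  exact CommaMorphism.ext (congrArg (fun x => x.iso.hom) hl) (congrArg (fun x => x.iso.hom) hr)

theorem CutGrpd.w {c d : CutGrpd.{w} P} (φ : c ⟶ d) :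
    CutGrpd.lower ((lowerTree P).map φ) ≫ d.of.obj.hom =
      c.of.obj.hom ≫ CutGrpd.total ((totalTree P).map φ) :=
  Arrow.w ((IsCut.{w} P).ι.map φ.iso.hom)

/-- The embedding of the target cut is a monomorphism, so the component on lower trees is recovered
from the one on total trees. -/
instance : (totalTree.{w} P).Faithful where
  map_injective {c d φ φ'} h := by
    refine CutGrpd.hom_ext (Core.hom_ext ?_) h
    have := PTree.Hom.mono_of_edge_injective
      (PTree.Hom.edge_injective d.of.obj.hom d.of.property)
    have h' : CutGrpd.lower ((lowerTree P).map φ) ≫ d.of.obj.hom =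
        CutGrpd.lower ((lowerTree P).map φ') ≫ d.of.obj.hom := by
      rw [CutGrpd.w, CutGrpd.w, h]
    exact (cancel_mono d.of.obj.hom).1 h'

variable (P) in
/-- The comparison of the roots of the upper forest with the leaves of the lower tree. -/
noncomputable def cutCell (c : CutGrpd.{w} P) :
    (rootF P).obj ((upperForest P).obj c) ⟶ (leafT P).obj ((lowerTree P).obj c) :=
  Fam.Hom.mk (fun a => a) Function.bijective_id fun a =>
    PTree.Hom.invCell c.of.obj.hom a.1

theorem cutCell_naturality {c d : CutGrpd.{w} P} (φ : c ⟶ d) :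
    (rootF P).map ((upperForest P).map φ) ≫ cutCell P d =
      cutCell P c ≫ (leafT P).map ((lowerTree P).map φ) := by
  refine Fam.hom_ext' (fun _ => rfl) fun a => ?_
  exact (PTree.Hom.cell_square_iff d.of.obj.hom rfl (cut_square P φ a.1)
    (congrArg d.of.obj.right.edgeDec (cut_square P φ a.1))).2
      (PTree.edgeCell_of_eq (CutGrpd.w φ).symm a.1)

variable {c d e : CutGrpd.{w} P}

/-- The restriction of a morphism of upper forests to a tree of the forest, as a morphism to the
total tree. -/
def toTotal (p : (upperForest P).obj c ⟶ (upperForest P).obj d)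
    (a : {a : c.of.obj.left.Edge // c.of.obj.left.IsLeaf a}) :
    c.of.obj.right.ideal (c.of.obj.hom.edge a.1) ⟶ d.of.obj.right :=
  (p.cell a).iso.hom ≫ d.of.obj.right.idealι _

theorem toTotal_comp (p : (upperForest P).obj c ⟶ (upperForest P).obj d)
    (p' : (upperForest P).obj d ⟶ (upperForest P).obj e) (a) :
    toTotal (p ≫ p') a = (p.cell a).iso.hom ≫ toTotal p' (p.toFun a) :=
  Category.assoc (p.cell a).iso.hom (p'.cell (p.toFun a)).iso.hom _

theorem toTotal_id (a) : toTotal (𝟙 ((upperForest P).obj c)) a = c.of.obj.right.idealι _ :=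
  Category.id_comp _

theorem toTotal_map (φ : c ⟶ d) (a) : toTotal ((upperForest P).map φ) a =
    c.of.obj.right.idealι _ ≫ CutGrpd.total ((totalTree P).map φ) :=
  PTree.restrict_idealι ((totalTree P).map φ).iso.hom _ _ (cut_square P φ a.1)

theorem upperForest_hom_ext {p p' : (upperForest P).obj c ⟶ (upperForest P).obj d}
    (h : ∀ a, p.toFun a = p'.toFun a) (h' : ∀ a, toTotal p a = toTotal p' a) : p = p' := by
  obtain ⟨f, hf, p⟩ := p
  obtain ⟨f', hf', p'⟩ := p'
  obtain rfl : f = f' := funext h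
  have : p = p' := funext fun a => Core.hom_ext
    ((cancel_mono (d.of.obj.right.idealι (d.of.obj.hom.edge (f a).1))).1 (h' a))
  rw [this]

theorem CutGrpd.hom_ext_of_layers {φ φ' : c ⟶ d}
    (hl : (lowerTree P).map φ = (lowerTree P).map φ')
    (hu : (upperForest P).map φ = (upperForest P).map φ') : φ = φ' := by
  refine CutGrpd.hom_ext hl (Core.hom_ext ?_)
  refine PTree.cut_hom_ext (k := CutGrpd.total _) (k' := CutGrpd.total _) c.of.obj.hom
    c.of.property ?_ fun a => ?_
  · rw [← CutGrpd.w, ← CutGrpd.w, hl]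
  · rw [← toTotal_map, ← toTotal_map, hu]

/-- Compatibility of `p` and `q` over `Fam I` is, leaf by leaf, the gluing condition along the cut,
both for edges and for cells. -/
theorem exists_total (p : (upperForest P).obj c ⟶ (upperForest P).obj d)
    (q : (lowerTree P).obj c ⟶ (lowerTree P).obj d)
    (h : (rootF P).map p ≫ cutCell P d = cutCell P c ≫ (leafT P).map q) :
    ∃ k : c.of.obj.right ⟶ d.of.obj.right, c.of.obj.hom ≫ k = CutGrpd.lower q ≫ d.of.obj.hom ∧
      ∀ a : {a : c.of.obj.left.Edge // c.of.obj.left.IsLeaf a},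
        c.of.obj.right.idealι _ ≫ k = toTotal p a := by
  have key : ∀ {X Y : Fam.{w} I} {f g : Fam.Hom X Y} (h : f = g) (i : X.idx),
      ∃ e : f.toFun i = g.toFun i, f.cell i ≫ eqToHom (congrArg Y.obj e) = g.cell i := by
    rintro X Y f _ rfl i
    exact ⟨rfl, by simp⟩
  have hroot : ∀ a, ((toTotal p a).edge (c.of.obj.right.ideal _).root) =
      d.of.obj.hom.edge (p.toFun a).1 := fun a =>
    congrArg Subtype.val (PTree.iso_root (p.cell a).iso)
  have hedge : ∀ a, (p.toFun a).1 = q.iso.hom.edge a.1 := fun a =>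
    congrArg Subtype.val (key h a).1
  refine PTree.exists_cut_hom c.of.obj.hom c.of.property _ (toTotal p)
    (fun a => (hroot a).trans (congrArg d.of.obj.hom.edge (hedge a))) fun a => ?_
  refine (PTree.Hom.cell_square_iff d.of.obj.hom (hedge a) (hroot a) _).1 ?_
  obtain ⟨e, he⟩ := key h a
  refine Eq.trans ?_ he
  have h1 : (toTotal p a).edgeCell (c.of.obj.right.ideal _).root =
    (p.cell a).iso.hom.edgeCell (c.of.obj.right.ideal _).root := Category.comp_id _
  rw [h1]
  rfl

/-- An isomorphism of the upper forests and an isomorphism of the lower trees that agree along the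
cuts come from an isomorphism of cuts. -/
theorem exists_cutHom (p : (upperForest P).obj c ⟶ (upperForest P).obj d)
    (q : (lowerTree P).obj c ⟶ (lowerTree P).obj d)
    (h : (rootF P).map p ≫ cutCell P d = cutCell P c ≫ (leafT P).map q) :
    ∃ φ : c ⟶ d, (upperForest P).map φ = p ∧ (lowerTree P).map φ = q := by
  have h' : (rootF P).map (inv p) ≫ cutCell P c = cutCell P d ≫ (leafT P).map (inv q) := by
    rw [Functor.map_inv, Functor.map_inv, IsIso.inv_comp_eq, ← Category.assoc,
      IsIso.eq_comp_inv, h]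
  obtain ⟨k, hk, hk'⟩ := exists_total p q h
  obtain ⟨l, hl, hl'⟩ := exists_total (inv p) (inv q) h'
  -- The maps glued from `p`, `q` and from their inverses are mutually inverse, because this can be
  -- checked on the pieces. The claim is stated for arbitrary cuts so that it serves for both
  -- composites.
  have key : ∀ {c d : CutGrpd.{w} P} (p : (upperForest P).obj c ⟶ (upperForest P).obj d)
      (q : (lowerTree P).obj c ⟶ (lowerTree P).obj d)
      (p' : (upperForest P).obj d ⟶ (upperForest P).obj c)
      (q' : (lowerTree P).obj d ⟶ (lowerTree P).obj c) (k : c.of.obj.right ⟶ d.of.obj.right)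
      (l : d.of.obj.right ⟶ c.of.obj.right), p ≫ p' = 𝟙 _ → q ≫ q' = 𝟙 _ →
      c.of.obj.hom ≫ k = CutGrpd.lower q ≫ d.of.obj.hom →
      (∀ a, c.of.obj.right.idealι _ ≫ k = toTotal p a) →
      d.of.obj.hom ≫ l = CutGrpd.lower q' ≫ c.of.obj.hom →
      (∀ a, d.of.obj.right.idealι _ ≫ l = toTotal p' a) → k ≫ l = 𝟙 _ := by
    intro c d p q p' q' k l hp hq hk hk' hl hl'
    refine PTree.cut_hom_ext c.of.obj.hom c.of.property ?_ fun a => ?_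
    · rw [← Category.assoc, hk, Category.assoc, hl, ← Category.assoc]
      refine (congrArg (· ≫ c.of.obj.hom) (congrArg (fun x => x.iso.hom) hq)).trans ?_
      exact (Category.id_comp _).trans (Category.comp_id _).symm
    · rw [← Category.assoc, hk', Category.comp_id, ← toTotal_id, ← hp, toTotal_comp]
      refine (Category.assoc _ _ _).trans (congrArg (_ ≫ ·) ?_)
      exact hl' (p.toFun a)
  let κ : c.of.obj.right ≅ d.of.obj.right :=
    ⟨k, l, key p q (inv p) (inv q) k l (by simp) (by simp) hk hk' hl hl',
      key (inv p) (inv q) p q l k (by simp) (by simp) hl hl' hk hk'⟩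
  let φ : c ⟶ d := CoreHom.mk ((IsCut.{w} P).isoMk (Arrow.isoMk q.iso κ hk.symm))
  have hφ : (lowerTree P).map φ = q := Core.hom_ext rfl
  refine ⟨φ, upperForest_hom_ext (fun a => ?_) fun a => ?_, hφ⟩
  · have := congrFun (congrArg Fam.Hom.toFun h) a
    exact this.symm
  · rw [toTotal_map, ← hk']
    rfl

theorem map_inv_eq {C : Type*} {D : Type*} [Category* C] [Groupoid D] (F : C ⥤ D) {x y : C}
    {i : x ⟶ y} [IsIso i] {z : D} {a : z ⟶ F.obj x} {b : z ⟶ F.obj y}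
    (h : F.map i = inv a ≫ b) : F.map (inv i) = inv b ≫ a := by
  rw [← cancel_epi (F.map i), ← F.map_comp, IsIso.hom_inv_id, F.map_id, h]
  simp

/-- Every tree with a forest of trees to be grafted onto its leaves comes from a cut. -/
theorem exists_cut (x : ForestGrpd.{w} P) (S : TreeGrpd.{w} P)
    (α : (rootF P).obj x ⟶ (leafT P).obj S) :
    ∃ (c : CutGrpd.{w} P) (p : (upperForest P).obj c ⟶ x) (q : (lowerTree P).obj c ⟶ S),
      (rootF P).map p ≫ α = cutCell P c ≫ (leafT P).map q := by
  -- Grafting needs a tree for each leaf, so the bijection from trees to leaves is inverted.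
  let β := inv α
  let F : {a : S.of.Edge // S.of.IsLeaf a} → PTree.{w} P := fun a => (x.obj (β.toFun a)).of
  let γ : ∀ a : {a : S.of.Edge // S.of.IsLeaf a}, S.of.edgeDec a.1 ⟶ (F a).edgeDec (F a).root :=
    β.cell
  let c : CutGrpd.{w} P := ⟨⟨Arrow.mk (PTree.Graft.ι S.of F γ none),
    PTree.Graft.emb_none_root S.of F γ⟩⟩
  -- Each grafted tree preserves leaves, so it is isomorphic to the ideal subtree generated by its
  -- leaf of `S`; these isomorphisms identify the upper forest of `c` with `x`.
  let j := fun a => PTree.Hom.toIdeal (PTree.Graft.ι S.of F γ (some a)) _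
    (PTree.Graft.emb_some_root S.of F γ a)
  have hj : ∀ a, IsIso (j a) := fun a => PTree.Hom.isIso_toIdeal _ _ _
    (PTree.Graft.ι_isLeaf S.of F γ a)
  let i : ∀ a, (⟨F a⟩ : TreeGrpd.{w} P) ⟶ ((upperForest P).obj c).obj a :=
    fun a => CoreHom.mk (@asIso _ _ _ _ (j a) (hj a))
  let p : (upperForest P).obj c ⟶ x := Fam.Hom.mk β.toFun β.bij fun a => inv (i a)
  refine ⟨c, p, 𝟙 S, ?_⟩
  rw [← IsIso.eq_comp_inv]
  refine Fam.hom_ext' (fun _ => rfl) fun a => ?_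
  have hi : (rootT P).map (i a) = inv (γ a) ≫ (PTree.Graft.ι S.of F γ none).edgeCell a.1 :=
    PTree.Graft.emb_some_root_cell S.of F γ a
  have hi' : (rootT P).map (inv (i a)) =
      PTree.Hom.invCell (PTree.Graft.ι S.of F γ none) a.1 ≫ γ a :=
    map_inv_eq (rootT P) hi
  refine (Category.comp_id _).trans (hi'.trans ?_)
  exact (congrArg (· ≫ γ a) (Category.comp_id _)).symm

end

/-! ### The homotopy sums -/

variable (P : PolyEndo I E B) (v : I)

theorem zigzag_hom {C : Type*} [Category* C] (h : ∀ {x y : C} (f : x ⟶ y), IsIso f) {x y : C}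
    (hxy : Zigzag x y) : Nonempty (x ⟶ y) := by
  induction hxy with
  | refl => exact ⟨𝟙 _⟩
  | tail _ hz ih =>
    obtain ⟨f⟩ := ih
    rcases hz with ⟨⟨g⟩⟩ | ⟨⟨g⟩⟩
    · exact ⟨f ≫ g⟩
    · have := h g
      exact ⟨f ≫ inv g⟩

/-- Faithfulness is that of `totalTree`. Fullness holds because cuts in the same component of a
fibre are joined by a zigzag of isomorphisms, hence by a single arrow. -/
theorem toSumCuts_isEquivalence : (toSumCuts.{w} P v).IsEquivalence where
  faithful := ⟨fun {X Z} u u' h => by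
    have hb : u.base = u'.base := congrArg (Grothendieck.forget (CostructuredArrow.proj (rootT P) v ⋙
      cutSet P ⋙ typeToCat)).map h
    refine FibreSum.hom_ext ((totalTree P).map_injective ?_)
    rw [← cancel_mono (FibreSum.fib Z).hom, FibreSum.w, FibreSum.w, hb]⟩
  full := ⟨fun {X Z} u => by
    have h : Zigzag ((CostructuredArrow.map u.base.left).obj (FibreSum.fib X))
      (FibreSum.fib Z) := Quotient.exact (s := Zigzag.setoid _) (Discrete.eq_of_hom u.fiber)
    obtain ⟨f⟩ := zigzag_hom (fun f => isIso_of_reflects_iso f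
      (CostructuredArrow.proj (totalTree P) Z.base.left)) h
    exact ⟨⟨u.base, f⟩, Grothendieck.ext _ _ rfl (Subsingleton.elim (α := ULift (PLift _)) _ _)⟩⟩
  essSurj := ⟨fun ⟨b, ⟨x⟩⟩ => by
    obtain ⟨y, rfl⟩ := Quotient.exists_rep (s := Zigzag.setoid _) x
    exact ⟨⟨b, y⟩, ⟨Iso.refl _⟩⟩⟩

/-- The functor from the homotopy sum of the homotopy fibres `_T𝐂` that sends a cut to its upper
forest and its lower tree, which agree along the cut. -/
noncomputable def sumCutFibresToProd : SumCutFibres.{w} P v ⥤ SumProdFibres.{w} P v :=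
  ProdFibres.lift (f := rootF P) (g := CostructuredArrow.proj (rootT P) v ⋙ leafT P) (cutProj P v)
    (fun X => cutCell P (FibreSum.fib X).left) (fun u => cutCell_naturality (FibreSum.left u))

/-- The functor `sumCutFibresToProd` lies over `𝐅 × 𝐓_v`. -/
noncomputable def sumCutFibresToProdProj :
    sumCutFibresToProd.{w} P v ⋙ sumProdFibresProj P v ≅ cutProj P v :=
  ProdFibres.liftProj (f := rootF P) (g := CostructuredArrow.proj (rootT P) v ⋙ leafT P)
    (cutProj P v) (fun X => cutCell P (FibreSum.fib X).left)
    (fun u => cutCell_naturality (FibreSum.left u))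

theorem sumCutFibresToProd_isEquivalence : (sumCutFibresToProd.{w} P v).IsEquivalence := by
  refine ProdFibres.lift_isEquivalence (f := rootF P)
    (g := CostructuredArrow.proj (rootT P) v ⋙ leafT P) (cutProj P v) _
    (fun u => cutCell_naturality (FibreSum.left u)) ⟨fun {X Z} u u' h => ?_⟩ (fun X Z p q h => ?_)
    fun x y α => ?_
  · exact FibreSum.hom_ext (CutGrpd.hom_ext_of_layers
      (congrArg (fun x => x.2.left) h) (congrArg Prod.fst h))
  · obtain ⟨φ, h1, h2⟩ := exists_cutHom (c := (FibreSum.fib X).left) (d := (FibreSum.fib Z).left)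
      p q.left h
    -- The arrow `q` is compatible with `v` at the root of the lower tree; naturality of
    -- `cutRootIso` transfers this to the total tree.
    have hq : (rootT P).map ((lowerTree P).map φ) ≫ cutRootIso P (FibreSum.fib Z).left ≫
        (rootT P).map (FibreSum.fib Z).hom ≫ Z.base.hom =
      cutRootIso P (FibreSum.fib X).left ≫ (rootT P).map (FibreSum.fib X).hom ≫ X.base.hom :=
      (congrArg (fun t => (rootT P).map t ≫ cutRootIso P (FibreSum.fib Z).left ≫
        (rootT P).map (FibreSum.fib Z).hom ≫ Z.base.hom) h2).trans (CostructuredArrow.w q)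
    rw [← Category.assoc, cutRootIso_naturality, Category.assoc, cancel_epi] at hq
    obtain ⟨u, rfl⟩ := FibreSum.exists_hom X Z φ hq
    exact ⟨u, h1, CostructuredArrow.hom_ext _ _ h2⟩
  · obtain ⟨c, p, q, h⟩ := exists_cut x y.left α
    -- The total tree of the graft is coloured at its root through the root of the lower tree, so
    -- that `q` becomes an arrow over `v`; the cut itself is placed in the fibre by the identity.
    let Z : SumCutFibres.{w} P v :=
      ⟨CostructuredArrow.mk (Y := (totalTree P).obj c)
        (inv (cutRootIso P c) ≫ (rootT P).map q ≫ y.hom),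
        (CostructuredArrow.mk (𝟙 ((totalTree P).obj c)) :
          CostructuredArrow (totalTree P) ((totalTree P).obj c))⟩
    have hp : IsIso p := inferInstance
    refine ⟨Z, p, CostructuredArrow.homMk q ?_, hp,
      isIso_of_reflects_iso _ (CostructuredArrow.proj (rootT P) v), h⟩
    change (rootT P).map q ≫ y.hom = cutRootIso P c ≫ (rootT P).map (𝟙 _) ≫
      inv (cutRootIso P c) ≫ (rootT P).map q ≫ y.hom
    simp

end

end FaaDiBruno

theorem mainTheorem6 {I : Type uI} {E : Type uE} {B : Type uB}
    [Groupoid.{vI} I] [Groupoid.{vE} E] [Groupoid.{vB} B]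
    (P : FaaDiBruno.PolyEndo I E B) (v : I) :
    (FaaDiBruno.toSumCuts.{w} P v).IsEquivalence ∧
    ∃ Φ : FaaDiBruno.SumCuts.{w} P v ≌ FaaDiBruno.SumProdFibres.{w} P v,
      Nonempty (FaaDiBruno.toSumCuts P v ⋙ Φ.functor ⋙ FaaDiBruno.sumProdFibresProj P v ≅
        FaaDiBruno.cutProj P v) := by
  have h := FaaDiBruno.toSumCuts_isEquivalence.{w} P v
  have h' := FaaDiBruno.sumCutFibresToProd_isEquivalence.{w} P v
  let e := (FaaDiBruno.toSumCuts.{w} P v).asEquivalence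
  let G := (FaaDiBruno.sumCutFibresToProd.{w} P v).asEquivalence
  refine ⟨h, e.symm.trans G, ⟨?_⟩⟩
  -- The functor of `Φ` is an inverse of `q` followed by the functor to the product fibres, so
  -- precomposing with `q` cancels the inverse up to isomorphism.
  exact (Functor.isoWhiskerRight e.unitIso.symm
    (G.functor ⋙ FaaDiBruno.sumProdFibresProj P v) ≪≫ Functor.leftUnitor _) ≪≫
      FaaDiBruno.sumCutFibresToProdProj P v
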